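/- **Setting.** Let $\mathcal X$ be a finite non-empty data universe. A database is a histogram $\mathcal D\in\mathbb N^{\mathcal X}$; $\mathcal D,\mathcal D'$ are adjacent if $\|\mathcal D-\mathcal D'\|_1\le 1$. A linear query is a vector $Q\in[0,1]^{\mathcal X}$ with $Q(\mathcal D)=\sum_x Q(x)\mathcal D(x)$. Let $n_2,k\ge1$ be integers, $\epsilon,\delta,\beta\in(0,1]$, all of them public parameters, and put $$\gamma=\sqrt{\frac{3000\sqrt{n_2|\mathcal X|}\,\log(4/\delta)\log(2k/\beta)}{\epsilon}},\quad B=\Big\lceil \frac{n_2|\mathcal X|}{\gamma^2}\Big\rceil,\quad \sigma=\frac{1000\sqrt B\log(4/\delta)}{\epsilon},\quad T=4\sigma\log(2k/\beta).$$ **Mechanism.** The online mechanism with the Frieze/Kannan update rule $\mathbf U^{FK}_\gamma$ starts with $\mathcal D^{(1)}=0\in\mathbb R^{\mathcal X}$ and $C=0$. In round $t=1,\dots,k$ it receives a query $Q^{(t)}$, draws independent noise $z_t\sim\mathrm{Lap}(\sigma)$, and sets $\hat r=Q^{(t)}(\mathcal D)+z_t$, $f=Q^{(t)}(\mathcal D^{(t)})$.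 If $|\hat r-f|\le T$ it answers $f$ and keeps $\mathcal D^{(t+1)}=\mathcal D^{(t)}$. Otherwise it answers $\hat r$, increases $C$ by one, and sets $\mathcal D^{(t+1)}=\mathcal D^{(t)}-\frac{\gamma}{|\mathcal X|}Q^{(t)}$ if $f>\hat r$, and $\mathcal D^{(t+1)}=\mathcal D^{(t)}+\frac{\gamma}{|\mathcal X|}Q^{(t)}$ if $f<\hat r$. When $C=B$ it terminates and leaves all later queries unanswered. The queries are chosen from a class $\mathcal Q$ by an arbitrary adaptive (possibly randomized) analyst on the basis of the previous answers. The output of the mechanism is the transcript of the queries and answers, together with the analyst's random seed. **Statement.** There is an absolute constant $K>0$ such that the following holds. 1. Let $\mathcal Q$ be any class of linear queries on $\mathcal X$. For every analyst the mechanism is $(\epsilon,\delta)$-differentially private: for all adjacent $\mathcal D,\mathcal D'$ and all events $S$, $\Pr[M(\mathcal D)\in S]\le e^{\epsilon}\Pr[M(\mathcal D')\in S]+\delta$. If moreover $\delta\le 1/2$ and $k/\beta\ge2$, then for every analyst and every $\mathcal D$ with $\|\mathcal D\|_2^2\le n_2$ (in particular if $n_2=\|\mathcal D\|_2^2$), with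 probability at least $1-\beta$ all $k$ queries are answered, each with error at most $$\alpha=K\,\frac{n_2^{1/4}|\mathcal X|^{1/4}\sqrt{\log(k/\beta)\log(1/\delta)}}{\sqrt\epsilon}.$$ 2. Let $V$ be a finite set with $|V|\ge2$ and let $\mathcal X$ be the set of the $\binom{|V|}{2}$ possible edges. A graph $G=(V,E)$ is the database $E$, and for $S,T\subseteq V$ the cut query $Q_{S,T}$ has the value $A_G(S,T)=\sum_{i\in S,j\in T}(A_G)_{ij}$, with $A_G$ the adjacency matrix. Let $k=2^{2|V|}$ (the number of pairs $S,T$), let $\delta,\beta\le1/2$, let $m\ge1$ be an integer, and run the mechanism with $n_2=m$ on the linear queries $\frac12Q_{S,T}$ (the factor $\frac12$ makes the coefficients lie in $[0,1]$ when $S$ and $T$ overlap), doubling its answers. It is $(\epsilon,\delta)$-differentially private, and for every analyst and every $G$ with $|E|\le m$ (in particular for $m=|E|$), with probability at least $1-\beta$ all $k$ cut queries asked are answered, each with error at most $$K\,\frac{|V|\,m^{1/4}\sqrt{\log(1/\beta)\log(1/\delta)}}{\sqrt\epsilon},$$ which for $m=|E|$ is $\tilde O(|V||E|^{1/4}/\sqrt\epsilon)$.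 -/

import Mathlib

open MeasureTheory

/-- The Laplace distribution centred at `0` with scale `b`. -/
noncomputable def laplaceDistribution (b : ℝ) : Measure ℝ :=
  volume.withDensity fun x => ENNReal.ofReal (1 / (2 * b) * Real.exp (-|x| / b))

/-- A linear query is a vector in `[0,1]^X`. -/
def IsLinearQuery {X : Type*} (q : X → ℝ) : Prop :=
  ∀ x, 0 ≤ q x ∧ q x ≤ 1

/-- The value `Q · D` of a query on a (real-valued) histogram. -/
def queryValue {X : Type*} [Fintype X] (q D : X → ℝ) : ℝ :=
  ∑ x, q x * D x

/-- A database in `ℕ^X`, seen as a real vector. -/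
def realHistogram {X : Type*} (D : X → ℕ) : X → ℝ :=
  fun x => (D x : ℝ)

/-- Adjacent databases: `‖D - D'‖₁ ≤ 1`. -/
def AdjacentDatabases {X : Type*} [Fintype X] (D D' : X → ℕ) : Prop :=
  ∑ x, |(D x : ℝ) - (D' x : ℝ)| ≤ 1

/-- `(ε, δ)`-differential privacy of a randomized algorithm `M` whose coins have law `μ`. -/
def IsDifferentiallyPrivate {X : Type*} [Fintype X] {Coins R : Type*} [MeasurableSpace Coins]
    [MeasurableSpace R] (ε δ : ℝ) (μ : Measure Coins) (M : (X → ℕ) → Coins → R) : Prop :=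
  ∀ D D' : X → ℕ, AdjacentDatabases D D' → ∀ S : Set R, MeasurableSet S →
    μ {c | M D c ∈ S} ≤ ENNReal.ofReal (Real.exp ε) * μ {c | M D' c ∈ S} + ENNReal.ofReal δ

/-- What the mechanism returns in one round: a real answer `Sum.inr a`, or `Sum.inl ()` if it has
already terminated. -/
abbrev RoundAnswer : Type := Unit ⊕ ℝ

/-- A data analyst with random seed in `Ω` who adaptively chooses queries from the class `𝒬`: the
query of round `t` (rounds are numbered from `0`) is a measurable function of the seed and of the
answers to the `t` preceding queries. -/
structure Analyst {X : Type*} (Ω : Type*) [MeasurableSpace Ω] (𝒬 : Set (X → ℝ)) where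
  ask : (t : ℕ) → Ω × (Fin t → RoundAnswer) → X → ℝ
  measurable_ask : ∀ t, Measurable (ask t)
  ask_mem : ∀ t h, ask t h ∈ 𝒬

/-- An update rule `U(D, Q, r)`. The argument `none` is the symbol `∅` ("no data structure yet"),
and `U(∅, ·, ·)` is the initial data structure. -/
abbrev UpdateRule (X : Type*) : Type _ := Option (X → ℝ) → (X → ℝ) → ℝ → (X → ℝ)

/-- One round of the online query release mechanism with update bound `B` and threshold `T`, on
database `D`, query `q` and noise `z`. The state `s` consists of the current data structure and of
the number `C` of updates made so far; the mechanism has terminated once `C` has reached `B`. -/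
noncomputable def mechanismRound {X : Type*} [Fintype X] (U : UpdateRule X) (B : ℕ) (T : ℝ)
    (D : X → ℕ) (q : X → ℝ) (z : ℝ) (s : (X → ℝ) × ℕ) : RoundAnswer × ((X → ℝ) × ℕ) :=
  let noisy := queryValue q (realHistogram D) + z
  let fake := queryValue q s.1
  if B ≤ s.2 then (Sum.inl (), s)
  else if |noisy - fake| ≤ T then (Sum.inr fake, s)
  else (Sum.inr noisy, (U (some s.1) q noisy, s.2 + 1))

/-- The answers given in the first `t` rounds and the state of the mechanism after them. -/
noncomputable def interaction {X : Type*} [Fintype X] {Ω : Type*} [MeasurableSpace Ω]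
    {𝒬 : Set (X → ℝ)} (U : UpdateRule X) (B : ℕ) (T : ℝ) (A : Analyst Ω 𝒬) (D : X → ℕ)
    (ω : Ω) (z : ℕ → ℝ) : (t : ℕ) → (Fin t → RoundAnswer) × ((X → ℝ) × ℕ)
  | 0 => (Fin.elim0, (U none 0 0, 0))
  | t + 1 =>
    let s := interaction U B T A D ω z t
    let r := mechanismRound U B T D (A.ask t (ω, s.1)) (z t) s.2
    (Fin.snoc (α := fun _ => RoundAnswer) s.1 r.1, r.2)

/-- The transcript (all queries with their answers) of the `k`-round interaction of the mechanism
with the analyst `A`, together with the analyst's seed, as a function of the coins: the analyst's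
seed and the noise values of the `k` rounds. -/
noncomputable def onlineMechanism {X : Type*} [Fintype X] {Ω : Type*} [MeasurableSpace Ω]
    {𝒬 : Set (X → ℝ)} (U : UpdateRule X) (B : ℕ) (T : ℝ) (k : ℕ) (A : Analyst Ω 𝒬)
    (D : X → ℕ) (c : Ω × (Fin k → ℝ)) : Ω × (Fin k → (X → ℝ) × RoundAnswer) :=
  let z : ℕ → ℝ := fun i => if h : i < k then c.2 ⟨i, h⟩ else 0
  (c.1, fun i =>
    let s := interaction U B T A D c.1 z i
    let q := A.ask i (c.1, s.1)
    (q, (mechanismRound U B T D q (z i) s.2).1))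

/-- The noise scale `σ` of the online mechanism with update bound `B`. -/
noncomputable def noiseScale (B : ℕ) (ε δ : ℝ) : ℝ :=
  1000 * Real.sqrt B * Real.log (4 / δ) / ε

/-- The threshold `T` of the online mechanism with update bound `B`. -/
noncomputable def updateThreshold (B : ℕ) (ε δ β : ℝ) (k : ℕ) : ℝ :=
  4 * noiseScale B ε δ * Real.log (2 * k / β)

/-- Law of the coins: the analyst's seed, and independent Laplace noise for each of `k` rounds. -/
noncomputable def coinLaw {Ω : Type*} [MeasurableSpace Ω] (P : Measure Ω) (k : ℕ) (σ : ℝ) :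
    Measure (Ω × (Fin k → ℝ)) :=
  P.prod (Measure.pi fun _ : Fin k => laplaceDistribution σ)

open Classical in
/-- The Frieze/Kannan update rule with parameter `γ`. -/
noncomputable def fkUpdate {X : Type*} [Fintype X] (γ : ℝ) : UpdateRule X
  | none, _, _ => 0
  | some D, q, r =>
    if 0 < queryValue q D - r then D - (γ / Fintype.card X) • q
    else if queryValue q D - r < 0 then D + (γ / Fintype.card X) • q
    else D

/-- The bound `n₂ |X| / γ²` on the number of Frieze/Kannan updates, rounded up to an integer. -/
noncomputable def fkBound (X : Type*) [Fintype X] (n₂ : ℕ) (γ : ℝ) : ℕ :=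
  ⌈(n₂ : ℝ) * Fintype.card X / γ ^ 2⌉₊

/-- The parameter `γ` of the Frieze/Kannan rule: the positive solution of `γ = 3 T / 4` for
`T = 4 σ log (2k/β)`, `σ = 1000 √B log (4/δ) / ε` and `B = n₂ |X| / γ²` (before rounding). -/
noncomputable def fkGamma (X : Type*) [Fintype X] (n₂ : ℕ) (ε δ β : ℝ) (k : ℕ) : ℝ :=
  Real.sqrt (3000 * Real.sqrt ((n₂ : ℝ) * Fintype.card X) * Real.log (4 / δ)
    * Real.log (2 * k / β) / ε)

/-- The update bound with which the Frieze/Kannan mechanism is run. -/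
noncomputable def fkMaxUpdates (X : Type*) [Fintype X] (n₂ : ℕ) (ε δ β : ℝ) (k : ℕ) : ℕ :=
  fkBound X n₂ (fkGamma X n₂ ε δ β k)

/-- The online query release mechanism instantiated with the Frieze/Kannan update rule. -/
noncomputable def fkMechanism {X : Type*} [Fintype X] {Ω : Type*} [MeasurableSpace Ω]
    {𝒬 : Set (X → ℝ)} (n₂ : ℕ) (ε δ β : ℝ) (k : ℕ) (A : Analyst Ω 𝒬)
    (D : X → ℕ) (c : Ω × (Fin k → ℝ)) : Ω × (Fin k → (X → ℝ) × RoundAnswer) :=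
  onlineMechanism (fkUpdate (fkGamma X n₂ ε δ β k)) (fkMaxUpdates X n₂ ε δ β k)
    (updateThreshold (fkMaxUpdates X n₂ ε δ β k) ε δ β k) k A D c

/-- Law of the coins of the Frieze/Kannan mechanism and of the analyst. -/
noncomputable def fkCoinLaw (X : Type*) [Fintype X] {Ω : Type*} [MeasurableSpace Ω]
    (P : Measure Ω) (n₂ : ℕ) (ε δ β : ℝ) (k : ℕ) : Measure (Ω × (Fin k → ℝ)) :=
  coinLaw P k (noiseScale (fkMaxUpdates X n₂ ε δ β k) ε δ)

/-- Every query of the transcript has been answered, with error at most `α` on `D`. -/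
def AnswersAccurate {X : Type*} [Fintype X] {k : ℕ} (α : ℝ) (D : X → ℕ)
    (tr : Fin k → (X → ℝ) × RoundAnswer) : Prop :=
  ∀ t, ∃ a : ℝ, (tr t).2 = Sum.inr a ∧ |queryValue (tr t).1 (realHistogram D) - a| ≤ α

/-- The universe of all possible edges on the vertex set `V`. -/
abbrev PossibleEdge (V : Type*) : Type _ := {e : Sym2 V // ¬ e.IsDiag}

open Classical in
/-- A graph as a database: its edge set. -/
noncomputable def edgeDatabase {V : Type*} (G : SimpleGraph V) : PossibleEdge V → ℕ :=
  fun e => if e.1 ∈ G.edgeSet then 1 else 0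

open Classical in
/-- The value `A_G(S, T)` of the cut `S, T`, where `A_G` is the adjacency matrix. -/
noncomputable def cutValue {V : Type*} [Fintype V] (G : SimpleGraph V) (S T : Finset V) : ℝ :=
  ∑ i ∈ S, ∑ j ∈ T, G.adjMatrix ℝ i j

/-- The cut query for `S, T` as a linear query on possible edges. Since an edge inside `S ∩ T` is
counted twice by `A_G(S, T)`, the coefficients are halved to lie in `[0,1]`; hence the value of this
query on the edge set of `G` is `A_G(S, T) / 2`. -/
noncomputable def cutQuery {V : Type*} [DecidableEq V] (S T : Finset V) : PossibleEdge V → ℝ :=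
  fun e => (((S ×ˢ T).filter fun p => s(p.1, p.2) = e.1).card : ℝ) / 2

/-- The class of all cut queries. -/
def cutQueries (V : Type*) [DecidableEq V] : Set (PossibleEdge V → ℝ) :=
  {q | ∃ S T : Finset V, q = cutQuery S T}

/-- Every cut query of the transcript has been answered, and twice the answer is within `α` of the
value of the cut in `G`. -/
def CutAnswersAccurate {V : Type*} [Fintype V] [DecidableEq V] {k : ℕ} (α : ℝ) (G : SimpleGraph V)
    (tr : Fin k → (PossibleEdge V → ℝ) × RoundAnswer) : Prop :=
  ∀ t, ∃ a : ℝ, (tr t).2 = Sum.inr a ∧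
    ∀ S T : Finset V, (tr t).1 = cutQuery S T → |cutValue G S T - 2 * a| ≤ α

/-!
Privacy and accuracy of the online query release mechanism with the Frieze/Kannan update rule.

*Privacy.* The noise protects each single round only at the level `1 / σ`, and there may be many
more rounds than updates, so one has to see that rounds without an update cost almost nothing. Let
`p`, `p'` be the probabilities of no update in a round on two adjacent databases and `q = 1 - p`.
If there is an update, the privacy loss is at most `1 / σ`; if there is none, it is `log (p / p')`,
and since `q` and `q'` agree up to a factor `exp (± 1 / σ)` as well, this is `O(q / σ)` when `p` is
not small. Hence the mean and the second moment of the loss are `O(q / σ²)`, i.e. a round costs in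
proportion to the probability of an update. In exponential form
(`lintegral_exp_roundLoss_le`): the moment `E exp (λ · loss - κ · [update])` is at most `1` for
some `κ = O(λ² / σ²)`. So `exp (λ · total loss - κ · number of updates)` is a supermartingale
(`lintegral_exp_loss_chainLaw_le`), and as there are at most `B` updates, Chernoff's inequality
bounds the probability that the total loss exceeds `ε` by `exp (κ B - λ ε)`, which is at most `δ`
for `λ = log (4 / δ) / ε`. Off this event the likelihood ratio is at most `exp ε`
(`chainLaw_apply_le`). The analyst's seed is fixed throughout and integrated out at the end; a state
of the mechanism is a function of the answers given, so it is common to both databases.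

*Accuracy.* With probability at least `1 - β` all noise values are at most `T / 4`. Then an update
happens only if the current error exceeds `3 T / 4 ≥ γ`, and it lowers the squared distance of the
data structure to the database, initially at most `n₂`, by more than `γ² / |X|`
(`fk_interaction_potential`). So the `B`-th update never happens, and all answers are within
`5 T / 4`. Because `B` is rounded up, `T` can be much larger than `γ`, but only if
`γ > √(n₂ |X|)`; in that case there is no update at all, and every query has value at most
`√(n₂ |X|)` (`fk_answersAccurate`).

Cut queries are the case in which the universe consists of the possible edges, where `|X| ≤ |V|²`
and `log (k / β) = O(|V| log (1 / β))` (`cut_error_le`).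
-/

/-! ### The Laplace distribution -/

theorem lintegral_laplaceDistribution (b : ℝ) {F : ℝ → ENNReal} (hF : Measurable F) :
    ∫⁻ z, F z ∂laplaceDistribution b
      = ∫⁻ z, ENNReal.ofReal (1 / (2 * b) * Real.exp (-|z| / b)) * F z := by
  rw [laplaceDistribution, lintegral_withDensity_eq_lintegral_mul _ (by fun_prop) hF]
  rfl

/-- The two-sided exponential tail: `P(|z| > s) = exp (-s / b)`. -/
theorem laplaceDistribution_tail {b : ℝ} (hb : 0 < b) {s : ℝ} (hs : 0 ≤ s) :
    laplaceDistribution b {z | s < |z|} = ENNReal.ofReal (Real.exp (-s / b)) := by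
  have hmeas : MeasurableSet {z : ℝ | s < |z|} := measurableSet_lt measurable_const (by fun_prop)
  have hsplit : {z : ℝ | s < |z|} = Set.Ioi s ∪ Set.Iio (-s) := by
    ext z
    simp only [Set.mem_ofPred_eq, lt_abs, Set.mem_union, Set.mem_Ioi, Set.mem_Iio]
    constructor <;> rintro (h | h)
    · exact Or.inl h
    · exact Or.inr (by linarith)
    · exact Or.inl h
    · exact Or.inr (by linarith)
  have hdisj : Disjoint (Set.Ioi s) (Set.Iio (-s)) := by
    rw [Set.disjoint_left]
    intro z h1 h2
    simp only [Set.mem_Ioi, Set.mem_Iio] at h1 h2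
    linarith
  have hright : ∫⁻ z in Set.Ioi s, ENNReal.ofReal (1 / (2 * b) * Real.exp (-|z| / b))
      = ENNReal.ofReal (Real.exp (-s / b) / 2) := by
    have h1 : ∫⁻ z in Set.Ioi s, ENNReal.ofReal (1 / (2 * b) * Real.exp (-|z| / b))
        = ∫⁻ z in Set.Ioi s, ENNReal.ofReal (1 / (2 * b) * Real.exp (-b⁻¹ * z)) := by
      refine setLIntegral_congr_fun measurableSet_Ioi fun z hz => ?_
      simp only [Set.mem_Ioi] at hz
      simp only [abs_of_pos (hs.trans_lt hz)]
      congr 3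
      field_simp
    have hi : IntegrableOn (fun z => 1 / (2 * b) * Real.exp (-b⁻¹ * z)) (Set.Ioi s) :=
      (integrableOn_exp_mul_Ioi (by simpa using hb) s).const_mul _
    rw [h1, ← ofReal_integral_eq_lintegral_ofReal hi (Filter.Eventually.of_forall fun z => by
      positivity), integral_const_mul, integral_exp_mul_Ioi (by simpa using hb)]
    congr 1
    have : -b⁻¹ * s = -s / b := by field_simp
    rw [this]
    field_simp
  have hleft : ∫⁻ z in Set.Iio (-s), ENNReal.ofReal (1 / (2 * b) * Real.exp (-|z| / b))
      = ENNReal.ofReal (Real.exp (-s / b) / 2) := by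
    rw [← hright]
    have := (Measure.measurePreserving_neg (volume : Measure ℝ)).setLIntegral_comp_preimage
      (s := Set.Iio (-s)) measurableSet_Iio
      (f := fun z => ENNReal.ofReal (1 / (2 * b) * Real.exp (-|z| / b))) (by fun_prop)
    rw [← this]
    simp
  rw [laplaceDistribution, withDensity_apply _ hmeas, hsplit,
    lintegral_union measurableSet_Iio hdisj, hright, hleft, ← ENNReal.ofReal_add (by positivity)
    (by positivity)]
  congr 1
  ring

theorem isProbabilityMeasure_laplaceDistribution {b : ℝ} (hb : 0 < b) :
    IsProbabilityMeasure (laplaceDistribution b) := by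
  constructor
  have h0 : laplaceDistribution b {0} = 0 := by
    rw [laplaceDistribution]
    exact withDensity_absolutelyContinuous _ _ (by simp)
  -- The tail bound at `s = 0` gives the mass of the complement of `{0}`.
  have h1 : laplaceDistribution b {0}ᶜ = 1 := by
    have := laplaceDistribution_tail hb le_rfl
    rw [show {z : ℝ | 0 < |z|} = {0}ᶜ by ext; simp] at this
    simpa using this
  rw [← measure_add_measure_compl (measurableSet_singleton (0 : ℝ)), h0, h1, zero_add]

/-- Change of centre: the law of `v + z` has density `exp ((|r - v'| - |r - v|) / b)` with respect
to that of `v' + z`. -/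
theorem lintegral_laplaceDistribution_add (b v v' : ℝ) {F : ℝ → ENNReal}
    (hF : Measurable F) :
    ∫⁻ z, F (v + z) ∂laplaceDistribution b
      = ∫⁻ z, F (v' + z) * ENNReal.ofReal (Real.exp ((|v' + z - v'| - |v' + z - v|) / b))
          ∂laplaceDistribution b := by
  rw [lintegral_laplaceDistribution b (by fun_prop), lintegral_laplaceDistribution b (by fun_prop)]
  rw [← lintegral_add_left_eq_self _ (v' - v)]
  refine lintegral_congr fun z => ?_
  rw [show v + (v' - v + z) = v' + z by ring, mul_comm (F _), ← mul_assoc,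
    ← ENNReal.ofReal_mul' (Real.exp_pos _).le, mul_assoc, ← Real.exp_add]
  congr 4
  rw [show v' + z - v' = z by ring, show v' + z - v = v' - v + z by ring]
  ring

/-! ### The privacy loss of one round -/

theorem exp_le_one_add_add_sq {x : ℝ} (hx : |x| ≤ 1) : Real.exp x ≤ 1 + x + x ^ 2 := by
  have := (abs_le.1 (Real.abs_exp_sub_one_sub_id_le hx)).2
  linarith

/-- A bounded random loss `w` is, to first order, `1 - exp (-w)`, whose mean is a difference of
probabilities; the damping `κ` absorbs the second-order terms. -/
theorem exp_mul_sub_le {e lam κ w : ℝ} (he1 : e ≤ 1) (hlam : 0 ≤ lam) (hle : lam * e ≤ 1 / 2)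
    (hκ : κ = 10 * (lam + lam ^ 2) * e ^ 2) (hκ1 : κ ≤ 1 / 4) (hw : |w| ≤ e) :
    Real.exp (lam * w - κ)
      ≤ 1 + lam * (1 - Real.exp (-w)) - 3 * (lam + lam ^ 2) * e ^ 2 := by
  have hw2 : w ^ 2 ≤ e ^ 2 := by
    rw [← sq_abs]
    exact pow_le_pow_left₀ (abs_nonneg _) hw 2
  have hκ0 : 0 ≤ κ := by rw [hκ]; positivity
  have hlw : |lam * w| ≤ 1 / 2 := by
    rw [abs_mul, abs_of_nonneg hlam]
    exact (mul_le_mul_of_nonneg_left hw hlam).trans hle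
  have h1 : Real.exp (lam * w - κ) ≤ 1 + (lam * w - κ) + (lam * w - κ) ^ 2 := by
    apply exp_le_one_add_add_sq
    rw [abs_le] at hlw ⊢
    constructor <;> linarith [hlw.1, hlw.2]
  have h2 : Real.exp (-w) ≤ 1 + -w + (-w) ^ 2 :=
    exp_le_one_add_add_sq (by rw [abs_neg]; exact hw.trans he1)
  have h3 : (lam * w - κ) ^ 2 ≤ 2 * lam ^ 2 * e ^ 2 + 2 * κ ^ 2 := by
    nlinarith [sq_nonneg (lam * w + κ), mul_le_mul_of_nonneg_left hw2 (sq_nonneg lam)]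
  have h4 : lam * (1 - Real.exp (-w)) ≥ lam * w - lam * e ^ 2 := by
    nlinarith
  have h5 : κ ^ 2 ≤ κ / 4 := by nlinarith
  have h6 : 0 ≤ lam * e ^ 2 := by positivity
  nlinarith

/-- The loss `log (p / p')` of a non-update costs only in proportion to the probability
`q = 1 - p` of an update. -/
theorem mul_exp_mul_log_div_le {e lam p p' q q' : ℝ} (he : 0 ≤ e) (he1 : e ≤ 1 / 2)
    (hlam : 0 ≤ lam) (hle : lam * e ≤ 1 / 2) (hp : 0 < p) (hp' : 0 < p') (hq : 0 ≤ q)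
    (hq' : 0 ≤ q') (hpq : p + q = 1) (hpq' : p' + q' = 1) (h1 : p ≤ Real.exp e * p')
    (h2 : p' ≤ Real.exp e * p)
    (h3 : q ≤ Real.exp e * q') (h4 : q' ≤ Real.exp e * q) :
    p * Real.exp (lam * Real.log (p / p'))
      ≤ p + lam * (p - p') + 3 * (lam + lam ^ 2) * e ^ 2 * q := by
  have hE : Real.exp e ≤ 1 + e + e ^ 2 :=
    exp_le_one_add_add_sq (by rw [abs_of_nonneg he]; linarith)
  have hE1 : Real.exp e ≤ 1 + 3 / 2 * e := by nlinarith
  have hE2 : Real.exp e ≤ 7 / 4 := by linarith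
  set x := Real.log (p / p') with hx
  have hexp : Real.exp (-x) = p' / p := by
    rw [Real.exp_neg, hx, Real.exp_log (by positivity), inv_div]
  have hpx : p * Real.exp (-x) = p' := by rw [hexp]; field_simp
  have hxe : |x| ≤ e := by
    rw [abs_le, hx]
    constructor
    · rw [Real.le_log_iff_exp_le (by positivity), Real.exp_neg, ← one_div,
        div_le_div_iff₀ (Real.exp_pos _) hp']
      linarith
    · rw [Real.log_le_iff_le_exp (by positivity), div_le_iff₀ hp']
      exact h1
  have hdiff1 : p - p' ≤ 3 / 2 * e * q := by
    have : Real.exp e * q ≤ (1 + 3 / 2 * e) * q := mul_le_mul_of_nonneg_right hE1 hq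
    linarith
  have hdiff2 : p' - p ≤ 3 / 2 * e * q := by
    have h5 : (1 - 3 / 2 * e) * Real.exp e ≤ 1 := by nlinarith
    have h6 : (1 - 3 / 2 * e) * q ≤ (1 - 3 / 2 * e) * (Real.exp e * q') :=
      mul_le_mul_of_nonneg_left h3 (by linarith)
    have h7 : (1 - 3 / 2 * e) * Real.exp e * q' ≤ 1 * q' := mul_le_mul_of_nonneg_right h5 hq'
    linarith
  have hpabs : p * |x| ≤ 3 * e * q := by
    have heq : 0 ≤ e * q := by positivity
    rcases le_total 0 x with h | h
    · rw [abs_of_nonneg h]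
      have hlog : x ≤ p / p' - 1 := by rw [hx]; exact Real.log_le_sub_one_of_pos (by positivity)
      have h5 : p' * x ≤ p - p' := by
        calc p' * x ≤ p' * (p / p' - 1) := mul_le_mul_of_nonneg_left hlog hp'.le
          _ = p - p' := by field_simp
      have h6 : p * x ≤ Real.exp e * (p' * x) := by
        rw [← mul_assoc]; exact mul_le_mul_of_nonneg_right h1 h
      have h7 : Real.exp e * (p' * x) ≤ 7 / 4 * (p' * x) :=
        mul_le_mul_of_nonneg_right hE2 (by positivity)
      linarith
    · rw [abs_of_nonpos h]
      have hlog : -x ≤ p' / p - 1 := by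
        rw [hx, ← Real.log_inv, inv_div]; exact Real.log_le_sub_one_of_pos (by positivity)
      have h5 : p * -x ≤ p' - p := by
        calc p * -x ≤ p * (p' / p - 1) := mul_le_mul_of_nonneg_left hlog hp.le
          _ = p' - p := by field_simp
      linarith
  -- One factor `|x|` is bounded by `e`, the other in terms of `q / p`: no case distinction on the
  -- size of `p` is needed.
  have hpx2 : p * x ^ 2 ≤ 3 * e ^ 2 * q := by
    calc p * x ^ 2 = (p * |x|) * |x| := by rw [← sq_abs]; ring
      _ ≤ (3 * e * q) * e := mul_le_mul hpabs hxe (abs_nonneg _) (by positivity)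
      _ = 3 * e ^ 2 * q := by ring
  have hexp1 : Real.exp (lam * x) ≤ 1 + lam * x + (lam * x) ^ 2 := by
    apply exp_le_one_add_add_sq
    rw [abs_mul, abs_of_nonneg hlam]
    nlinarith
  have hexp2 : Real.exp (-x) ≤ 1 + -x + (-x) ^ 2 :=
    exp_le_one_add_add_sq (by rw [abs_neg]; linarith)
  have hfirst : p * x ≤ p - p' + p * x ^ 2 := by nlinarith
  calc p * Real.exp (lam * x) ≤ p * (1 + lam * x + (lam * x) ^ 2) :=
        mul_le_mul_of_nonneg_left hexp1 hp.le
    _ = p + lam * (p * x) + lam ^ 2 * (p * x ^ 2) := by ring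
    _ ≤ p + lam * (p - p' + p * x ^ 2) + lam ^ 2 * (p * x ^ 2) := by gcongr
    _ = p + lam * (p - p') + (lam + lam ^ 2) * (p * x ^ 2) := by ring
    _ ≤ p + lam * (p - p') + (lam + lam ^ 2) * (3 * e ^ 2 * q) := by gcongr
    _ = _ := by ring

/-- The answer of a round on a query of value `v` with fake answer `f` and noise `z`: the fake
answer if the noisy one is within `T` of it, and the noisy answer otherwise. -/
noncomputable def thresholdAnswer (T f v z : ℝ) : ℝ :=
  if |v + z - f| ≤ T then f else v + z

/-- The probability that a noisy answer at distance `d` from the fake one leads to no update. -/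
noncomputable def acceptProb (b T d : ℝ) : ℝ :=
  (laplaceDistribution b).real {z | |d + z| ≤ T}

/-- The privacy loss of the answer `r` of a round: the logarithm of its likelihood ratio when the
query has value `v` on one database and `v'` on the other. The answer `r = f` is an atom of both
laws. -/
noncomputable def roundLoss (b T f v v' r : ℝ) : ℝ :=
  if r = f then Real.log (acceptProb b T (v - f) / acceptProb b T (v' - f))
  else (|r - v'| - |r - v|) / b

theorem acceptProb_pos {b T : ℝ} (hb : 0 < b) (hT : 0 < T) (d : ℝ) : 0 < acceptProb b T d := by
  have := isProbabilityMeasure_laplaceDistribution hb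
  rw [acceptProb, measureReal_def, ENNReal.toReal_pos_iff]
  refine ⟨?_, measure_lt_top _ _⟩
  have hac : (volume : Measure ℝ) ≪ laplaceDistribution b := by
    refine withDensity_absolutelyContinuous' (by fun_prop) (Filter.Eventually.of_forall fun x => ?_)
    have : 0 < 1 / (2 * b) * Real.exp (-|x| / b) := by positivity
    simpa using this
  rw [pos_iff_ne_zero]
  intro h0
  have h1 := hac h0
  have h2 : {z : ℝ | |d + z| ≤ T} = Metric.closedBall (-d) T := by
    ext z
    simp [Real.dist_eq, add_comm]
  rw [h2, Real.volume_closedBall] at h1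
  simp at h1
  linarith

theorem abs_loss_le {b v v' : ℝ} (hb : 0 < b) (hv : |v - v'| ≤ 1) (r : ℝ) :
    |(|r - v'| - |r - v|) / b| ≤ 1 / b := by
  rw [abs_div, abs_of_pos hb]
  gcongr
  refine (abs_abs_sub_abs_le _ _).trans ?_
  rwa [show r - v' - (r - v) = v - v' by ring]

theorem laplaceDistribution_real_add_mem {b : ℝ} (hb : 0 < b) (v v' : ℝ)
    {P : Set ℝ} (hP : MeasurableSet P) :
    (laplaceDistribution b).real {z | v' + z ∈ P}
      = ∫ z in {z | v + z ∈ P}, Real.exp (-((|v + z - v'| - |v + z - v|) / b))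
          ∂laplaceDistribution b := by
  have := isProbabilityMeasure_laplaceDistribution hb
  have hm : ∀ u : ℝ, MeasurableSet {z | u + z ∈ P} := fun u => hP.preimage (by fun_prop)
  have h := lintegral_laplaceDistribution_add b v' v (F := P.indicator 1)
    (measurable_one.indicator hP)
  have h1 : ∫⁻ z, P.indicator 1 (v' + z) ∂laplaceDistribution b
      = laplaceDistribution b {z | v' + z ∈ P} := by
    rw [← lintegral_indicator_one (hm v')]
    rfl
  have h2 : ∫⁻ z, P.indicator 1 (v + z)
        * ENNReal.ofReal (Real.exp ((|v + z - v| - |v + z - v'|) / b)) ∂laplaceDistribution b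
      = ∫⁻ z in {z | v + z ∈ P}, ENNReal.ofReal
        (Real.exp (-((|v + z - v'| - |v + z - v|) / b))) ∂laplaceDistribution b := by
    rw [← lintegral_indicator (hm v)]
    refine lintegral_congr fun z => ?_
    by_cases hz : v + z ∈ P
    · rw [Set.indicator_of_mem hz, Set.indicator_of_mem (by exact hz), Pi.one_apply, one_mul]
      congr 2
      ring
    · rw [Set.indicator_of_notMem hz, Set.indicator_of_notMem (by exact hz), zero_mul]
  rw [h1, h2] at h
  rw [measureReal_def, h, integral_eq_lintegral_of_nonneg_ae
    (Filter.Eventually.of_forall fun z => (Real.exp_pos _).le) (by fun_prop)]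

theorem integrable_exp_neg_loss {b : ℝ} (hb : 0 < b) {v v' : ℝ} (hv : |v - v'| ≤ 1) :
    Integrable (fun z => Real.exp (-((|v + z - v'| - |v + z - v|) / b)))
      (laplaceDistribution b) := by
  have := isProbabilityMeasure_laplaceDistribution hb
  refine Integrable.of_bound (by fun_prop) (Real.exp (1 / b))
    (Filter.Eventually.of_forall fun z => ?_)
  rw [Real.norm_eq_abs, abs_of_pos (Real.exp_pos _), Real.exp_le_exp]
  exact (neg_le_abs _).trans (abs_loss_le hb hv _)

theorem laplaceDistribution_real_add_mem_le {b : ℝ} (hb : 0 < b) {v v' : ℝ} (hv : |v - v'| ≤ 1)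
    {P : Set ℝ} (hP : MeasurableSet P) :
    (laplaceDistribution b).real {z | v' + z ∈ P}
      ≤ Real.exp (1 / b) * (laplaceDistribution b).real {z | v + z ∈ P} := by
  have := isProbabilityMeasure_laplaceDistribution hb
  rw [laplaceDistribution_real_add_mem hb v v' hP]
  calc _ ≤ ∫ z in {z | v + z ∈ P}, Real.exp (1 / b) ∂laplaceDistribution b := by
        refine setIntegral_mono (integrable_exp_neg_loss hb hv).integrableOn
          (integrable_const _).integrableOn fun z => ?_
        rw [Real.exp_le_exp]
        exact (neg_le_abs _).trans (abs_loss_le hb hv _)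
    _ = _ := by rw [setIntegral_const, smul_eq_mul, mul_comm]

theorem measurable_thresholdAnswer {α : Type*} [MeasurableSpace α] (T : ℝ) {f v z : α → ℝ}
    (hf : Measurable f) (hv : Measurable v) (hz : Measurable z) :
    Measurable fun x => thresholdAnswer T (f x) (v x) (z x) := by
  unfold thresholdAnswer
  exact Measurable.ite (measurableSet_le (by fun_prop) measurable_const) hf (hv.add hz)

theorem measurable_acceptProb {b : ℝ} (hb : 0 < b) (T : ℝ) : Measurable (acceptProb b T) := by
  have := isProbabilityMeasure_laplaceDistribution hb
  unfold acceptProb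
  have hs : MeasurableSet {p : ℝ × ℝ | |p.1 + p.2| ≤ T} :=
    measurableSet_le (by fun_prop) measurable_const
  exact (measurable_measure_prodMk_left hs).ennreal_toReal

theorem measurable_roundLoss {α : Type*} [MeasurableSpace α] {b : ℝ} (hb : 0 < b) (T : ℝ)
    {f v v' r : α → ℝ} (hf : Measurable f) (hv : Measurable v) (hv' : Measurable v')
    (hr : Measurable r) : Measurable fun x => roundLoss b T (f x) (v x) (v' x) (r x) := by
  unfold roundLoss
  have h1 := (measurable_acceptProb hb T).comp (hv.sub hf)
  have h2 := (measurable_acceptProb hb T).comp (hv'.sub hf)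
  exact Measurable.ite (measurableSet_eq_fun hr hf) (Real.measurable_log.comp (h1.div h2))
    (by fun_prop)

theorem measurableSet_updateRange (T f : ℝ) : MeasurableSet {r : ℝ | T < |r - f|} :=
  measurableSet_lt measurable_const (by fun_prop)

theorem lintegral_thresholdAnswer {b : ℝ} (hb : 0 < b) (T f v : ℝ) (F : ℝ → ENNReal) :
    ∫⁻ z, F (thresholdAnswer T f v z) ∂laplaceDistribution b
      = F f * ENNReal.ofReal (acceptProb b T (v - f))
        + ∫⁻ z, {r : ℝ | T < |r - f|}.indicator F (v + z) ∂laplaceDistribution b := by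
  have := isProbabilityMeasure_laplaceDistribution hb
  have hm : MeasurableSet {z : ℝ | T < |v + z - f|} :=
    measurableSet_lt measurable_const (by fun_prop)
  rw [← lintegral_add_compl _ hm, add_comm]
  congr 1
  · have : ∫⁻ z in {z : ℝ | T < |v + z - f|}ᶜ, F (thresholdAnswer T f v z) ∂laplaceDistribution b
        = ∫⁻ z in {z : ℝ | T < |v + z - f|}ᶜ, F f ∂laplaceDistribution b := by
      refine setLIntegral_congr_fun hm.compl fun z hz => ?_
      have hz' : |v + z - f| ≤ T := not_lt.1 hz
      simp only [thresholdAnswer, if_pos hz']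
    rw [this, setLIntegral_const, acceptProb, ofReal_measureReal]
    congr 2
    ext z
    simp [sub_add_eq_add_sub]
  · rw [← lintegral_indicator hm]
    refine lintegral_congr fun z => ?_
    by_cases hz : T < |v + z - f|
    · rw [Set.indicator_of_mem (by exact hz), Set.indicator_of_mem (by exact hz),
        thresholdAnswer, if_neg (not_le.2 hz)]
    · rw [Set.indicator_of_notMem (by exact hz), Set.indicator_of_notMem (by exact hz)]

/-- `exp roundLoss` is the density of the answer for `v` with respect to the answer for `v'`. -/
theorem lintegral_thresholdAnswer_eq {b T : ℝ} (hb : 0 < b) (hT : 0 < T) (f v v' : ℝ)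
    {F : ℝ → ENNReal} (hF : Measurable F) :
    ∫⁻ z, F (thresholdAnswer T f v z) ∂laplaceDistribution b
      = ∫⁻ z, F (thresholdAnswer T f v' z)
          * ENNReal.ofReal (Real.exp (roundLoss b T f v v' (thresholdAnswer T f v' z)))
          ∂laplaceDistribution b := by
  have hp := acceptProb_pos hb hT (v - f)
  have hp' := acceptProb_pos hb hT (v' - f)
  rw [lintegral_thresholdAnswer hb T f v F,
    lintegral_thresholdAnswer hb T f v'
      fun r => F r * ENNReal.ofReal (Real.exp (roundLoss b T f v v' r))]
  congr 1
  · rw [roundLoss, if_pos rfl, Real.exp_log (by positivity), mul_assoc,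
      ← ENNReal.ofReal_mul (by positivity), div_mul_cancel₀ _ hp'.ne']
  · rw [lintegral_laplaceDistribution_add b v v' (hF.indicator (measurableSet_updateRange T f))]
    refine lintegral_congr fun z => ?_
    by_cases hz : T < |v' + z - f|
    · have hne : v' + z ≠ f := by
        rintro h
        rw [h, sub_self, abs_zero] at hz
        linarith
      rw [Set.indicator_of_mem (by exact hz), Set.indicator_of_mem (by exact hz), roundLoss,
        if_neg hne]
    · rw [Set.indicator_of_notMem (by exact hz), Set.indicator_of_notMem (by exact hz), zero_mul]

/-- The exponential moment of the privacy loss of a round, damped by `exp (-κ)` in case of an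
update, is at most `1`. -/
theorem lintegral_exp_roundLoss_le {b T lam κ : ℝ} (hb : 2 ≤ b) (hT : 0 < T) (hlam : 0 ≤ lam)
    (hle : lam * (1 / b) ≤ 1 / 2) (hκ : κ = 10 * (lam + lam ^ 2) * (1 / b) ^ 2)
    (hκ1 : κ ≤ 1 / 4) {f v v' : ℝ} (hv : |v - v'| ≤ 1) :
    ∫⁻ z, ENNReal.ofReal (Real.exp (lam * roundLoss b T f v v' (thresholdAnswer T f v z)
        - if thresholdAnswer T f v z = f then 0 else κ)) ∂laplaceDistribution b ≤ 1 := by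
  have hb0 : 0 < b := by linarith
  have := isProbabilityMeasure_laplaceDistribution hb0
  have he1 : 1 / b ≤ 1 / 2 := one_div_le_one_div_of_le two_pos hb
  set μ := laplaceDistribution b with hμ
  set P : Set ℝ := {r : ℝ | T < |r - f|} with hPdef
  have hP : MeasurableSet P := measurableSet_updateRange T f
  have hm : ∀ u : ℝ, MeasurableSet {z | u + z ∈ P} := fun u => hP.preimage (by fun_prop)
  have hcompl : ∀ u : ℝ, acceptProb b T (u - f) = μ.real {z | u + z ∈ Pᶜ} := by
    intro u
    rw [acceptProb]
    congr 1
    ext z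
    simp [hPdef, sub_add_eq_add_sub]
  have hsum : ∀ u : ℝ, acceptProb b T (u - f) + μ.real {z | u + z ∈ P} = 1 := by
    intro u
    rw [hcompl, add_comm]
    exact probReal_add_probReal_compl (hm u)
  have hv' : |v' - v| ≤ 1 := by rwa [abs_sub_comm]
  have hscalar := mul_exp_mul_log_div_le (e := 1 / b) (by positivity) he1 hlam hle
    (acceptProb_pos hb0 hT (v - f)) (acceptProb_pos hb0 hT (v' - f)) measureReal_nonneg
    measureReal_nonneg
    (hsum v) (hsum v')
    (by rw [hcompl, hcompl]; exact laplaceDistribution_real_add_mem_le hb0 hv' hP.compl)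
    (by rw [hcompl, hcompl]; exact laplaceDistribution_real_add_mem_le hb0 hv hP.compl)
    (laplaceDistribution_real_add_mem_le hb0 hv' hP)
    (laplaceDistribution_real_add_mem_le hb0 hv hP)
  set ρ : ℝ := 3 * (lam + lam ^ 2) * (1 / b) ^ 2 with hρ
  set w : ℝ → ℝ := fun z => (|v + z - v'| - |v + z - v|) / b with hw
  have hpoint : ∀ z, Real.exp (lam * w z - κ) ≤ 1 + lam * (1 - Real.exp (-w z)) - ρ := fun z =>
    exp_mul_sub_le (by linarith) hlam hle hκ hκ1 (abs_loss_le hb0 hv _)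
  have hint : Integrable (fun z => Real.exp (-w z)) μ := integrable_exp_neg_loss hb0 hv
  have hintH : Integrable (fun z => 1 + lam * (1 - Real.exp (-w z)) - ρ) μ :=
    ((integrable_const _).add (((integrable_const _).sub hint).const_mul _)).sub
      (integrable_const _)
  have hintegral : ∫ z in {z | v + z ∈ P}, (1 + lam * (1 - Real.exp (-w z)) - ρ) ∂μ
      = μ.real {z | v + z ∈ P}
        + lam * (μ.real {z | v + z ∈ P} - μ.real {z | v' + z ∈ P})
        - ρ * μ.real {z | v + z ∈ P} := by
    have hexp : ∫ z in {z | v + z ∈ P}, Real.exp (-w z) ∂μ = μ.real {z | v' + z ∈ P} :=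
      (laplaceDistribution_real_add_mem hb0 v v' hP).symm
    rw [show (fun z => 1 + lam * (1 - Real.exp (-w z)) - ρ)
      = fun z => (1 + lam - ρ) - lam * Real.exp (-w z) by ext z; ring,
      integral_sub (integrable_const _) (hint.integrableOn.const_mul _), integral_const_mul, hexp,
      setIntegral_const, smul_eq_mul]
    ring
  have hH0 : ∀ z, 0 ≤ 1 + lam * (1 - Real.exp (-w z)) - ρ := fun z =>
    (Real.exp_pos _).le.trans (hpoint z)
  rw [lintegral_thresholdAnswer hb0 T f v fun r => ENNReal.ofReal
    (Real.exp (lam * roundLoss b T f v v' r - if r = f then 0 else κ))]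
  have hsecond : ∫⁻ z, P.indicator (fun r => ENNReal.ofReal
      (Real.exp (lam * roundLoss b T f v v' r - if r = f then 0 else κ))) (v + z) ∂μ
      ≤ ENNReal.ofReal (∫ z in {z | v + z ∈ P}, (1 + lam * (1 - Real.exp (-w z)) - ρ) ∂μ) := by
    rw [ofReal_integral_eq_lintegral_ofReal hintH.integrableOn (Filter.Eventually.of_forall hH0),
      ← lintegral_indicator (hm v)]
    refine lintegral_mono fun z => ?_
    by_cases hz : v + z ∈ P
    · have hne : v + z ≠ f := by
        rintro h
        have hz' : T < |v + z - f| := hz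
        rw [h, sub_self, abs_zero] at hz'
        linarith
      rw [Set.indicator_of_mem hz, Set.indicator_of_mem (by exact hz), roundLoss, if_neg hne,
        if_neg hne]
      exact ENNReal.ofReal_le_ofReal (hpoint z)
    · rw [Set.indicator_of_notMem hz]
      exact zero_le
  refine (add_le_add le_rfl hsecond).trans ?_
  rw [hintegral, roundLoss, if_pos rfl, if_pos rfl, sub_zero,
    ← ENNReal.ofReal_mul (Real.exp_pos _).le, ← ENNReal.ofReal_add
      (mul_nonneg (Real.exp_pos _).le (acceptProb_pos hb0 hT _).le)
      (hintegral ▸ integral_nonneg hH0), ← ENNReal.ofReal_one]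
  refine ENNReal.ofReal_le_ofReal ?_
  have h1 := hsum v
  have h2 := hsum v'
  nlinarith

/-! ### Adaptive composition for Markov chains -/

/-- The law at time `t` of the Markov chain that starts in `e₀` and moves from `e` to `next t e z`
with fresh noise `z` of law `μ`. The state space may depend on time, so that a state can contain
the history. -/
noncomputable def chainLaw {E : ℕ → Type*} [∀ t, MeasurableSpace (E t)] (μ : Measure ℝ) (e₀ : E 0)
    (next : ∀ t, E t → ℝ → E (t + 1)) : ∀ t, Measure (E t)
  | 0 => Measure.dirac e₀
  | t + 1 => (μ.prod (chainLaw μ e₀ next t)).map fun p => next t p.2 p.1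

section Chain

variable {E : ℕ → Type*} [∀ t, MeasurableSpace (E t)] {μ : Measure ℝ} [IsProbabilityMeasure μ]

theorem isProbabilityMeasure_chainLaw {e₀ : E 0} {next : ∀ t, E t → ℝ → E (t + 1)}
    (hnext : ∀ t, Measurable fun p : E t × ℝ => next t p.1 p.2) (t : ℕ) :
    IsProbabilityMeasure (chainLaw μ e₀ next t) := by
  induction t with
  | zero => exact Measure.dirac.isProbabilityMeasure
  | succ t ih =>
    exact Measure.isProbabilityMeasure_map ((hnext t).comp measurable_swap).aemeasurable

theorem lintegral_chainLaw_succ {e₀ : E 0} {next : ∀ t, E t → ℝ → E (t + 1)}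
    (hnext : ∀ t, Measurable fun p : E t × ℝ => next t p.1 p.2) (t : ℕ)
    {F : E (t + 1) → ENNReal} (hF : Measurable F) :
    ∫⁻ e, F e ∂chainLaw μ e₀ next (t + 1)
      = ∫⁻ e, ∫⁻ z, F (next t e z) ∂μ ∂chainLaw μ e₀ next t := by
  have := isProbabilityMeasure_chainLaw (μ := μ) (e₀ := e₀) hnext t
  have hm : Measurable fun p : ℝ × E t => next t p.2 p.1 := (hnext t).comp measurable_swap
  rw [chainLaw, lintegral_map hF hm,
    lintegral_prod_symm' (fun p : ℝ × E t => F (next t p.2 p.1)) (hF.comp hm)]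

variable {Y : Type*} [MeasurableSpace Y]

/-- The chain driven by the answers `ans` in which the accumulated privacy loss is recorded. -/
def lossNext (step : ∀ t, E t → Y → E (t + 1)) (ans : ∀ t, E t → ℝ → Y) (ℓ : ∀ t, E t → Y → ℝ)
    (t : ℕ) (p : E t × ℝ) (z : ℝ) : E (t + 1) × ℝ :=
  (step t p.1 (ans t p.1 z), p.2 + ℓ t p.1 (ans t p.1 z))

variable {e₀ : E 0} {step : ∀ t, E t → Y → E (t + 1)} {ans ans' : ∀ t, E t → ℝ → Y}
  {ℓ : ∀ t, E t → Y → ℝ}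

theorem measurable_lossNext (hstep : ∀ t, Measurable fun p : E t × Y => step t p.1 p.2)
    (hans : ∀ t, Measurable fun p : E t × ℝ => ans t p.1 p.2)
    (hℓ : ∀ t, Measurable fun p : E t × Y => ℓ t p.1 p.2) (t : ℕ) :
    Measurable fun q : (E t × ℝ) × ℝ => lossNext step ans ℓ t q.1 q.2 := by
  have h : Measurable fun q : (E t × ℝ) × ℝ => (q.1.1, ans t q.1.1 q.2) :=
    (measurable_fst.comp measurable_fst).prodMk ((hans t).comp
      ((measurable_fst.comp measurable_fst).prodMk measurable_snd))
  exact ((hstep t).comp h).prodMk ((measurable_snd.comp measurable_fst).add ((hℓ t).comp h))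

theorem lintegral_chainLaw_lossNext_fst
    (hstep : ∀ t, Measurable fun p : E t × Y => step t p.1 p.2)
    (hans : ∀ t, Measurable fun p : E t × ℝ => ans t p.1 p.2)
    (hℓ : ∀ t, Measurable fun p : E t × Y => ℓ t p.1 p.2) (t : ℕ)
    {F : E t → ENNReal} (hF : Measurable F) :
    ∫⁻ p, F p.1 ∂chainLaw (E := fun t => E t × ℝ) μ (e₀, 0) (lossNext step ans ℓ) t
      = ∫⁻ e, F e ∂chainLaw μ e₀ (fun t e z => step t e (ans t e z)) t := by
  have hnext : ∀ t, Measurable fun p : E t × ℝ => step t p.1 (ans t p.1 p.2) := fun t =>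
    (hstep t).comp (measurable_fst.prodMk (hans t))
  induction t with
  | zero =>
    rw [chainLaw, chainLaw, lintegral_dirac' _ (by fun_prop), lintegral_dirac' _ hF]
  | succ t ih =>
    rw [lintegral_chainLaw_succ (E := fun t => E t × ℝ) (measurable_lossNext hstep hans hℓ) t
      (F := fun p => F p.1) (by fun_prop), lintegral_chainLaw_succ hnext t hF]
    exact ih (F := fun e => ∫⁻ z, F (step t e (ans t e z)) ∂μ)
      (Measurable.lintegral_prod_right' (hF.comp (hnext t)))

/-- If in every round `exp ℓ` is a density of the answer `ans` with respect to `ans'`, then the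
exponential of the accumulated loss is a density of the whole interaction. -/
theorem lintegral_chainLaw_change
    (hstep : ∀ t, Measurable fun p : E t × Y => step t p.1 p.2)
    (hans : ∀ t, Measurable fun p : E t × ℝ => ans t p.1 p.2)
    (hans' : ∀ t, Measurable fun p : E t × ℝ => ans' t p.1 p.2)
    (hℓ : ∀ t, Measurable fun p : E t × Y => ℓ t p.1 p.2)
    (hchange : ∀ t e (F : Y → ENNReal), Measurable F → ∫⁻ z, F (ans t e z) ∂μ
      = ∫⁻ z, F (ans' t e z) * ENNReal.ofReal (Real.exp (ℓ t e (ans' t e z))) ∂μ)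
    (t : ℕ) {F : E t × ℝ → ENNReal} (hF : Measurable F) :
    ∫⁻ p, F p ∂chainLaw (E := fun t => E t × ℝ) μ (e₀, 0) (lossNext step ans ℓ) t
      = ∫⁻ p, F p * ENNReal.ofReal (Real.exp p.2)
          ∂chainLaw (E := fun t => E t × ℝ) μ (e₀, 0) (lossNext step ans' ℓ) t := by
  induction t with
  | zero =>
    rw [chainLaw, chainLaw, lintegral_dirac' _ hF, lintegral_dirac' _ (by fun_prop)]
    simp
  | succ t ih =>
    have hn := measurable_lossNext hstep hans hℓ
    have hn' := measurable_lossNext hstep hans' hℓ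
    rw [lintegral_chainLaw_succ (E := fun t => E t × ℝ) hn t hF,
      lintegral_chainLaw_succ (E := fun t => E t × ℝ) hn' t
        (F := fun p => F p * ENNReal.ofReal (Real.exp p.2)) (by fun_prop)]
    rw [ih (F := fun p => ∫⁻ z, F (lossNext step ans ℓ t p z) ∂μ)
      (Measurable.lintegral_prod_right' (hF.comp (hn t)))]
    refine lintegral_congr fun p => ?_
    have hG : Measurable fun y : Y => F (step t p.1 y, p.2 + ℓ t p.1 y) :=
      hF.comp (((hstep t).comp measurable_prodMk_left).prodMk
        (measurable_const.add ((hℓ t).comp measurable_prodMk_left)))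
    have h := hchange t p.1 _ hG
    simp only [lossNext] at h ⊢
    rw [h, ← lintegral_mul_const']
    · refine lintegral_congr fun z => ?_
      rw [mul_assoc, ← ENNReal.ofReal_mul (Real.exp_pos _).le, ← Real.exp_add, add_comm p.2]
    · exact ENNReal.ofReal_ne_top

/-- The exponential of the accumulated loss, damped by `exp (-κ N)`, is a supermartingale. -/
theorem lintegral_exp_loss_chainLaw_le
    (hstep : ∀ t, Measurable fun p : E t × Y => step t p.1 p.2)
    (hans : ∀ t, Measurable fun p : E t × ℝ => ans t p.1 p.2)
    (hℓ : ∀ t, Measurable fun p : E t × Y => ℓ t p.1 p.2)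
    {N : ∀ t, E t → ℝ} (hN : ∀ t, Measurable (N t)) (hN0 : N 0 e₀ = 0) {lam κ : ℝ}
    (hmoment : ∀ t e, ∫⁻ z, ENNReal.ofReal (Real.exp (lam * ℓ t e (ans t e z)
      - κ * (N (t + 1) (step t e (ans t e z)) - N t e))) ∂μ ≤ 1) (t : ℕ) :
    ∫⁻ p, ENNReal.ofReal (Real.exp (lam * p.2 - κ * N t p.1))
      ∂chainLaw (E := fun t => E t × ℝ) μ (e₀, 0) (lossNext step ans ℓ) t ≤ 1 := by
  have hmeas : ∀ t, Measurable fun p : E t × ℝ =>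
      ENNReal.ofReal (Real.exp (lam * p.2 - κ * N t p.1)) := fun t => by
    have : Measurable fun p : E t × ℝ => N t p.1 := (hN t).comp measurable_fst
    exact ((measurable_snd.const_mul _).sub (this.const_mul _)).exp.ennreal_ofReal
  induction t with
  | zero =>
    rw [chainLaw, lintegral_dirac' _ (hmeas 0)]
    simp [hN0]
  | succ t ih =>
    rw [lintegral_chainLaw_succ (E := fun t => E t × ℝ) (measurable_lossNext hstep hans hℓ) t
      (hmeas (t + 1))]
    refine le_trans (lintegral_mono fun p => ?_) ih
    calc _ = ∫⁻ z, ENNReal.ofReal (Real.exp (lam * p.2 - κ * N t p.1))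
            * ENNReal.ofReal (Real.exp (lam * ℓ t p.1 (ans t p.1 z)
              - κ * (N (t + 1) (step t p.1 (ans t p.1 z)) - N t p.1))) ∂μ := by
          refine lintegral_congr fun z => ?_
          rw [← ENNReal.ofReal_mul (Real.exp_pos _).le, ← Real.exp_add]
          simp only [lossNext]
          congr 2
          ring
      _ = ENNReal.ofReal (Real.exp (lam * p.2 - κ * N t p.1)) * _ :=
          lintegral_const_mul' _ _ ENNReal.ofReal_ne_top
      _ ≤ ENNReal.ofReal (Real.exp (lam * p.2 - κ * N t p.1)) * 1 := by
          gcongr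
          exact hmoment t p.1
      _ = _ := mul_one _

/-- Adaptive composition: a Chernoff bound on the accumulated loss, whose exponential moment is
controlled by the bound `B` on the number `N` of costly rounds. -/
theorem chainLaw_apply_le
    (hstep : ∀ t, Measurable fun p : E t × Y => step t p.1 p.2)
    (hans : ∀ t, Measurable fun p : E t × ℝ => ans t p.1 p.2)
    (hans' : ∀ t, Measurable fun p : E t × ℝ => ans' t p.1 p.2)
    (hℓ : ∀ t, Measurable fun p : E t × Y => ℓ t p.1 p.2)
    (hchange : ∀ t e (F : Y → ENNReal), Measurable F → ∫⁻ z, F (ans t e z) ∂μ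
      = ∫⁻ z, F (ans' t e z) * ENNReal.ofReal (Real.exp (ℓ t e (ans' t e z))) ∂μ)
    {N : ∀ t, E t → ℝ} (hN : ∀ t, Measurable (N t)) (hN0 : N 0 e₀ = 0) {B lam κ : ℝ}
    (hNB : ∀ t e, N t e ≤ B) (hlam : 0 ≤ lam) (hκ : 0 ≤ κ)
    (hmoment : ∀ t e, ∫⁻ z, ENNReal.ofReal (Real.exp (lam * ℓ t e (ans t e z)
      - κ * (N (t + 1) (step t e (ans t e z)) - N t e))) ∂μ ≤ 1) (ε : ℝ) (t : ℕ)
    {S : Set (E t)} (hS : MeasurableSet S) :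
    chainLaw μ e₀ (fun t e z => step t e (ans t e z)) t S
      ≤ ENNReal.ofReal (Real.exp ε) * chainLaw μ e₀ (fun t e z => step t e (ans' t e z)) t S
        + ENNReal.ofReal (Real.exp (κ * B - lam * ε)) := by
  set M := chainLaw (E := fun t => E t × ℝ) μ (e₀, 0) (lossNext step ans ℓ) t with hM
  set M' := chainLaw (E := fun t => E t × ℝ) μ (e₀, 0) (lossNext step ans' ℓ) t with hM'
  have hind : Measurable (S.indicator (1 : E t → ENNReal)) := measurable_one.indicator hS
  have hind' : Measurable fun p : E t × ℝ => S.indicator (1 : E t → ENNReal) p.1 :=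
    hind.comp measurable_fst
  have hfst := lintegral_chainLaw_lossNext_fst (μ := μ) (e₀ := e₀) hstep hans hℓ t hind
  have hfst' := lintegral_chainLaw_lossNext_fst (μ := μ) (e₀ := e₀) hstep hans' hℓ t hind
  rw [lintegral_indicator_one hS] at hfst hfst'
  rw [← hfst, ← hfst', ← hM, ← hM']
  set L : Set (E t × ℝ) := {p | p.2 ≤ ε} with hLdef
  have hL : MeasurableSet L := measurableSet_le measurable_snd measurable_const
  rw [← lintegral_add_compl _ hL]
  refine add_le_add ?_ ?_
  · rw [← lintegral_indicator hL, lintegral_chainLaw_change hstep hans hans' hℓ hchange t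
      (hind'.indicator hL), ← lintegral_const_mul' _ _ ENNReal.ofReal_ne_top]
    refine lintegral_mono fun p => ?_
    by_cases hp : p ∈ L
    · rw [Set.indicator_of_mem hp, mul_comm]
      gcongr
      exact hp
    · rw [Set.indicator_of_notMem hp, zero_mul]
      exact zero_le
  · have hle := lintegral_exp_loss_chainLaw_le (μ := μ) hstep hans hℓ hN hN0 hmoment t
    rw [← hM] at hle
    have hpt : ∀ p : E t × ℝ, p ∈ Lᶜ → S.indicator (1 : E t → ENNReal) p.1
        ≤ ENNReal.ofReal (Real.exp (κ * B - lam * ε))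
          * ENNReal.ofReal (Real.exp (lam * p.2 - κ * N t p.1)) := by
      intro p hp
      have hp' : ε < p.2 := not_le.1 hp
      have h1 : S.indicator (1 : E t → ENNReal) p.1 ≤ 1 :=
        Set.indicator_le_self' (fun _ _ => zero_le) _
      refine h1.trans ?_
      rw [← ENNReal.ofReal_mul (Real.exp_pos _).le, ← Real.exp_add, ENNReal.one_le_ofReal,
        Real.one_le_exp_iff]
      nlinarith [mul_le_mul_of_nonneg_left hp'.le hlam,
        mul_le_mul_of_nonneg_left (hNB t p.1) hκ]
    calc _ ≤ ∫⁻ p in Lᶜ, ENNReal.ofReal (Real.exp (κ * B - lam * ε))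
          * ENNReal.ofReal (Real.exp (lam * p.2 - κ * N t p.1)) ∂M :=
          setLIntegral_mono' hL.compl hpt
      _ ≤ ∫⁻ p, ENNReal.ofReal (Real.exp (κ * B - lam * ε))
          * ENNReal.ofReal (Real.exp (lam * p.2 - κ * N t p.1)) ∂M := setLIntegral_le_lintegral _ _
      _ = ENNReal.ofReal (Real.exp (κ * B - lam * ε)) * _ :=
          lintegral_const_mul' _ _ ENNReal.ofReal_ne_top
      _ ≤ ENNReal.ofReal (Real.exp (κ * B - lam * ε)) * 1 := by gcongr
      _ = _ := mul_one _

end Chain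

/-! ### Privacy of the online mechanism -/

section Round

variable {X : Type*} [Fintype X]

/-- The real number in an answer, and `0` for the answer of a terminated mechanism. -/
def answerValue : RoundAnswer → ℝ := Sum.elim (fun _ => 0) id

/-- The answer of the online mechanism in one round, as a function of the noise. -/
noncomputable def roundAnswer (B : ℕ) (T : ℝ) (D : X → ℕ) (q : X → ℝ) (s : (X → ℝ) × ℕ)
    (z : ℝ) : RoundAnswer :=
  if B ≤ s.2 then Sum.inl ()
  else Sum.inr (thresholdAnswer T (queryValue q s.1) (queryValue q (realHistogram D)) z)

open Classical in
/-- The state after a round, as a function of the answer alone: an update has taken place exactly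
if the answer differs from the fake one. -/
noncomputable def stateAfter (U : UpdateRule X) (B : ℕ) (q : X → ℝ) (s : (X → ℝ) × ℕ)
    (y : RoundAnswer) : (X → ℝ) × ℕ :=
  if B ≤ s.2 then s
  else if answerValue y = queryValue q s.1 then s
  else (U (some s.1) q (answerValue y), s.2 + 1)

theorem mechanismRound_eq (U : UpdateRule X) (B : ℕ) {T : ℝ} (hT : 0 ≤ T) (D : X → ℕ) (q : X → ℝ)
    (z : ℝ) (s : (X → ℝ) × ℕ) :
    mechanismRound U B T D q z s
      = (roundAnswer B T D q s z, stateAfter U B q s (roundAnswer B T D q s z)) := by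
  unfold mechanismRound stateAfter roundAnswer thresholdAnswer
  by_cases hB : B ≤ s.2
  · simp [hB]
  · by_cases h : |queryValue q (realHistogram D) + z - queryValue q s.1| ≤ T
    · simp [hB, h, answerValue]
    · have hne : queryValue q (realHistogram D) + z ≠ queryValue q s.1 := by
        intro heq
        rw [heq, sub_self, abs_zero] at h
        exact h hT
      simp [hB, h, answerValue, hne]

theorem measurable_answerValue : Measurable answerValue :=
  measurable_const.sumElim measurable_id

theorem measurable_queryValue {α : Type*} [MeasurableSpace α] {q D : α → X → ℝ}
    (hq : Measurable q) (hD : Measurable D) : Measurable fun a => queryValue (q a) (D a) := by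
  unfold queryValue
  exact Finset.measurable_sum _ fun x _ =>
    ((measurable_pi_apply x).comp hq).mul ((measurable_pi_apply x).comp hD)

theorem measurable_roundAnswer {α : Type*} [MeasurableSpace α] (B : ℕ) (T : ℝ) (D : X → ℕ)
    {q : α → X → ℝ} {s : α → (X → ℝ) × ℕ} {z : α → ℝ} (hq : Measurable q) (hs : Measurable s)
    (hz : Measurable z) : Measurable fun a => roundAnswer B T D (q a) (s a) (z a) := by
  unfold roundAnswer
  refine Measurable.ite (measurableSet_le measurable_const hs.snd) measurable_const ?_
  exact measurable_inr.comp (measurable_thresholdAnswer T (measurable_queryValue hq hs.fst)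
    (measurable_queryValue hq measurable_const) hz)

theorem measurable_stateAfter {α : Type*} [MeasurableSpace α] {U : UpdateRule X}
    (hU : Measurable fun p : (X → ℝ) × (X → ℝ) × ℝ => U (some p.1) p.2.1 p.2.2) (B : ℕ)
    {q : α → X → ℝ} {s : α → (X → ℝ) × ℕ} {y : α → RoundAnswer} (hq : Measurable q)
    (hs : Measurable s) (hy : Measurable y) :
    Measurable fun a => stateAfter U B (q a) (s a) (y a) := by
  unfold stateAfter
  have hv := measurable_answerValue.comp hy
  refine Measurable.ite (measurableSet_le measurable_const hs.snd) hs ?_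
  refine Measurable.ite (measurableSet_eq_fun hv (measurable_queryValue hq hs.fst)) hs ?_
  exact (hU.comp (hs.fst.prodMk (hq.prodMk hv))).prodMk (hs.snd.add_const 1)

end Round

theorem measurable_finSnoc {α β : Type*} [MeasurableSpace α] [MeasurableSpace β] {t : ℕ}
    {h : α → Fin t → β} {y : α → β} (hh : Measurable h) (hy : Measurable y) :
    Measurable fun a => (Fin.snoc (α := fun _ => β) (h a) (y a) : Fin (t + 1) → β) := by
  rw [measurable_pi_iff]
  intro i
  refine Fin.lastCases ?_ (fun j => ?_) i
  · simpa only [Fin.snoc_last] using hy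
  · simp only [Fin.snoc_castSucc]
    exact (measurable_pi_apply j).comp hh

/-- The noise values of `k` rounds, extended by `0` to all rounds. -/
def zeroExtend {k : ℕ} (z : Fin k → ℝ) : ℕ → ℝ := fun i => if h : i < k then z ⟨i, h⟩ else 0

theorem measurable_zeroExtend {k : ℕ} : Measurable (zeroExtend : (Fin k → ℝ) → ℕ → ℝ) := by
  rw [measurable_pi_iff]
  intro i
  unfold zeroExtend
  by_cases h : i < k
  · simp only [h, dif_pos]
    exact measurable_pi_apply _
  · simp only [h, dif_neg, not_false_iff]
    exact measurable_const

/-- The transcript is determined by the seed and the answers. -/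
def transcriptOf {X Ω : Type*} [MeasurableSpace Ω] {𝒬 : Set (X → ℝ)} (A : Analyst Ω 𝒬) {k : ℕ}
    (p : Ω × (Fin k → RoundAnswer)) :
    Ω × (Fin k → (X → ℝ) × RoundAnswer) :=
  (p.1, fun i => (A.ask i (p.1, fun j : Fin i => p.2 (j.castLE i.2.le)), p.2 i))

theorem measurable_transcriptOf {X Ω : Type*} [MeasurableSpace Ω] {𝒬 : Set (X → ℝ)}
    (A : Analyst Ω 𝒬) {k : ℕ} : Measurable (transcriptOf (k := k) A) := by
  refine measurable_fst.prodMk (measurable_pi_iff.2 fun i => ?_)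
  refine ((A.measurable_ask i).comp (measurable_fst.prodMk
    (measurable_pi_iff.2 fun j => ?_))).prodMk ((measurable_pi_apply i).comp measurable_snd)
  exact (measurable_pi_apply _).comp measurable_snd

section Interaction

variable {X : Type*} [Fintype X] {Ω : Type*} [MeasurableSpace Ω] {𝒬 : Set (X → ℝ)}

/-- The answers and the state of the mechanism after `t` rounds. -/
abbrev RoundState (X : Type*) (t : ℕ) : Type _ := (Fin t → RoundAnswer) × ((X → ℝ) × ℕ)

/-- The effect of the answer `y` in round `t` on answers and state, for the analyst's seed `ω`. -/
noncomputable def roundStep (U : UpdateRule X) (B : ℕ) (A : Analyst Ω 𝒬) (ω : Ω) (t : ℕ)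
    (e : RoundState X t) (y : RoundAnswer) : RoundState X (t + 1) :=
  (Fin.snoc (α := fun _ => RoundAnswer) e.1 y, stateAfter U B (A.ask t (ω, e.1)) e.2 y)

/-- The answer in round `t` when the query is the one the analyst asks. -/
noncomputable def analystAnswer (B : ℕ) (T : ℝ) (A : Analyst Ω 𝒬) (D : X → ℕ) (ω : Ω) (t : ℕ)
    (e : RoundState X t) (z : ℝ) : RoundAnswer :=
  roundAnswer B T D (A.ask t (ω, e.1)) e.2 z

theorem interaction_succ (U : UpdateRule X) (B : ℕ) {T : ℝ} (hT : 0 ≤ T) (A : Analyst Ω 𝒬)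
    (D : X → ℕ) (ω : Ω) (z : ℕ → ℝ) (t : ℕ) :
    interaction U B T A D ω z (t + 1)
      = roundStep U B A ω t (interaction U B T A D ω z t)
          (analystAnswer B T A D ω t (interaction U B T A D ω z t) (z t)) := by
  rw [interaction, mechanismRound_eq U B hT]
  rfl

theorem interaction_congr (U : UpdateRule X) (B : ℕ) (T : ℝ) (A : Analyst Ω 𝒬)
    (D : X → ℕ) (ω : Ω) {z z' : ℕ → ℝ} {t : ℕ} (h : ∀ i < t, z i = z' i) :
    interaction U B T A D ω z t = interaction U B T A D ω z' t := by
  induction t with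
  | zero => rfl
  | succ t ih =>
    rw [interaction, interaction, ih fun i hi => h i (by omega), h t (by omega)]

theorem measurable_roundStep {α : Type*} [MeasurableSpace α] {U : UpdateRule X}
    (hU : Measurable fun p : (X → ℝ) × (X → ℝ) × ℝ => U (some p.1) p.2.1 p.2.2) (B : ℕ)
    (A : Analyst Ω 𝒬) (t : ℕ) {ω : α → Ω} {e : α → RoundState X t} {y : α → RoundAnswer}
    (hω : Measurable ω) (he : Measurable e) (hy : Measurable y) :
    Measurable fun a => roundStep U B A (ω a) t (e a) (y a) :=
  (measurable_finSnoc he.fst hy).prodMk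
    (measurable_stateAfter hU B ((A.measurable_ask t).comp (hω.prodMk he.fst)) he.snd hy)

theorem measurable_analystAnswer {α : Type*} [MeasurableSpace α] (B : ℕ) (T : ℝ)
    (A : Analyst Ω 𝒬) (D : X → ℕ) (t : ℕ) {ω : α → Ω} {e : α → RoundState X t} {z : α → ℝ}
    (hω : Measurable ω) (he : Measurable e) (hz : Measurable z) :
    Measurable fun a => analystAnswer B T A D (ω a) t (e a) (z a) :=
  measurable_roundAnswer B T D ((A.measurable_ask t).comp (hω.prodMk he.fst)) he.snd hz

theorem measurable_interaction {U : UpdateRule X}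
    (hU : Measurable fun p : (X → ℝ) × (X → ℝ) × ℝ => U (some p.1) p.2.1 p.2.2) (B : ℕ) {T : ℝ}
    (hT : 0 ≤ T) (A : Analyst Ω 𝒬) (D : X → ℕ) (t : ℕ) :
    Measurable fun p : Ω × (ℕ → ℝ) => interaction U B T A D p.1 p.2 t := by
  induction t with
  | zero => exact measurable_const
  | succ t ih =>
    simp only [interaction_succ U B hT]
    exact measurable_roundStep hU B A t measurable_fst ih
      (measurable_analystAnswer B T A D t measurable_fst ih
        ((measurable_pi_apply t).comp measurable_snd))

/-- The law of the interaction under independent noise is that of a Markov chain. -/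
theorem map_interaction_eq_chainLaw {U : UpdateRule X}
    (hU : Measurable fun p : (X → ℝ) × (X → ℝ) × ℝ => U (some p.1) p.2.1 p.2.2) (B : ℕ) {T : ℝ}
    (hT : 0 ≤ T) (A : Analyst Ω 𝒬) (D : X → ℕ) (ω : Ω) (μ : Measure ℝ) [IsProbabilityMeasure μ]
    (t : ℕ) :
    (Measure.pi fun _ : Fin t => μ).map
        (fun z => interaction U B T A D ω (zeroExtend z) t)
      = chainLaw (E := RoundState X) μ (Fin.elim0, (U none 0 0, 0))
        (fun t e z => roundStep U B A ω t e (analystAnswer B T A D ω t e z)) t := by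
  have hmeas : ∀ t, Measurable fun z : Fin t → ℝ =>
      interaction U B T A D ω (zeroExtend z) t := fun t =>
    (measurable_interaction hU B hT A D t).comp (measurable_const.prodMk measurable_zeroExtend)
  induction t with
  | zero =>
    rw [chainLaw]
    simp only [interaction]
    rw [Measure.map_const, measure_univ, one_smul]
  | succ t ih =>
    have hnext : Measurable fun p : ℝ × RoundState X t =>
        roundStep U B A ω t p.2 (analystAnswer B T A D ω t p.2 p.1) :=
      measurable_roundStep hU B A t measurable_const measurable_snd
        (measurable_analystAnswer B T A D t measurable_const measurable_snd measurable_fst)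
    have hpi := (measurePreserving_piFinSuccAbove (fun _ : Fin (t + 1) => μ) (Fin.last t)).map_eq
    have hprod := Measure.map_prod_map μ (Measure.pi fun _ : Fin t => μ) measurable_id (hmeas t)
    rw [Measure.map_id] at hprod
    rw [chainLaw, ← ih, hprod, ← hpi,
      Measure.map_map (measurable_id.prodMap (hmeas t)) (MeasurableEquiv.measurable _),
      Measure.map_map hnext ((measurable_id.prodMap (hmeas t)).comp (MeasurableEquiv.measurable _))]
    congr 1
    funext z
    have hcongr : interaction U B T A D ω (zeroExtend z) t
        = interaction U B T A D ω (zeroExtend (Fin.init z : Fin t → ℝ)) t := by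
      refine interaction_congr U B T A D ω fun i hi => ?_
      simp only [zeroExtend, hi, dif_pos, Nat.lt_succ_of_lt hi]
      rfl
    rw [interaction_succ U B hT, hcongr]
    have hlast : zeroExtend z t = z (Fin.last t) := by
      simp only [zeroExtend, Nat.lt_succ_self, dif_pos]
      rfl
    rw [hlast]
    simp [MeasurableEquiv.piFinSuccAbove, Fin.insertNthEquiv]

theorem interaction_fst_castLE (U : UpdateRule X) (B : ℕ) (T : ℝ) (A : Analyst Ω 𝒬) (D : X → ℕ)
    (ω : Ω) (z : ℕ → ℝ) {s t : ℕ} (h : s ≤ t) (j : Fin s) :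
    (interaction U B T A D ω z t).1 (j.castLE h) = (interaction U B T A D ω z s).1 j := by
  induction t with
  | zero =>
    obtain rfl : s = 0 := by omega
    exact j.elim0
  | succ t ih =>
    rcases Nat.lt_or_ge t s with hlt | hge
    · obtain rfl : s = t + 1 := by omega
      rfl
    · rw [← ih hge]
      have : j.castLE h = (j.castLE hge).castSucc := rfl
      rw [interaction, this]
      exact Fin.snoc_castSucc (α := fun _ => RoundAnswer) _ _ _

theorem onlineMechanism_eq_transcriptOf (U : UpdateRule X) (B : ℕ) (T : ℝ) (k : ℕ)
    (A : Analyst Ω 𝒬) (D : X → ℕ) (c : Ω × (Fin k → ℝ)) :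
    onlineMechanism U B T k A D c
      = transcriptOf A (c.1, (interaction U B T A D c.1 (zeroExtend c.2) k).1) := by
  unfold onlineMechanism transcriptOf
  refine Prod.ext rfl (funext fun i => ?_)
  have h1 : (fun j : Fin i => (interaction U B T A D c.1 (zeroExtend c.2) k).1
      (j.castLE i.2.le)) = (interaction U B T A D c.1 (zeroExtend c.2) i).1 :=
    funext fun j => interaction_fst_castLE U B T A D c.1 _ i.2.le j
  have h2 := interaction_fst_castLE U B T A D c.1 (zeroExtend c.2) (Nat.succ_le_of_lt i.2)
    (Fin.last i)
  have h3 : (Fin.last (i : ℕ)).castLE (Nat.succ_le_of_lt i.2) = i := rfl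
  rw [h3] at h2
  refine Prod.ext ?_ ?_
  · exact congrArg (fun h => A.ask i (c.1, h)) h1.symm
  · refine Eq.trans ?_ h2.symm
    simp only [Nat.succ_eq_add_one, interaction, Fin.snoc_last]
    rfl

theorem abs_queryValue_sub_le {q : X → ℝ} (hq : IsLinearQuery q) {D D' : X → ℕ}
    (h : AdjacentDatabases D D') :
    |queryValue q (realHistogram D) - queryValue q (realHistogram D')| ≤ 1 := by
  refine le_trans ?_ h
  unfold queryValue realHistogram
  rw [← Finset.sum_sub_distrib]
  refine (Finset.abs_sum_le_sum_abs _ _).trans (Finset.sum_le_sum fun x _ => ?_)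
  rw [← mul_sub, abs_mul, abs_of_nonneg (hq x).1]
  exact mul_le_of_le_one_left (abs_nonneg _) (hq x).2

/-- Privacy of the online mechanism, with a free parameter `lam` for the order of the exponential
moment of the privacy loss. -/
theorem onlineMechanism_isDifferentiallyPrivate {U : UpdateRule X}
    (hU : Measurable fun p : (X → ℝ) × (X → ℝ) × ℝ => U (some p.1) p.2.1 p.2.2) (B : ℕ)
    {T b lam κ : ℝ} (hT : 0 < T) (hb : 2 ≤ b) (hlam : 0 ≤ lam) (hle : lam * (1 / b) ≤ 1 / 2)
    (hκ : κ = 10 * (lam + lam ^ 2) * (1 / b) ^ 2) (hκ1 : κ ≤ 1 / 4)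
    (h𝒬 : ∀ q ∈ 𝒬, IsLinearQuery q) (P : Measure Ω) [IsProbabilityMeasure P] (k : ℕ)
    (A : Analyst Ω 𝒬) {ε δ : ℝ} (hδ : Real.exp (κ * B - lam * ε) ≤ δ) :
    IsDifferentiallyPrivate ε δ (coinLaw P k b) (onlineMechanism U B T k A) := by
  intro D D' hDD' S hS
  have hb0 : 0 < b := by linarith
  have := isProbabilityMeasure_laplaceDistribution hb0
  set μ := laplaceDistribution b with hμ
  have hκ0 : 0 ≤ κ := by rw [hκ]; positivity
  have hmeas : ∀ D : X → ℕ, Measurable (onlineMechanism U B T k A D) := by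
    intro D
    have h : Measurable fun c : Ω × (Fin k → ℝ) =>
        (interaction U B T A D c.1 (zeroExtend c.2) k).1 :=
      ((measurable_interaction hU B hT.le A D k).comp
        (measurable_fst.prodMk (measurable_zeroExtend.comp measurable_snd))).fst
    simp only [funext (onlineMechanism_eq_transcriptOf U B T k A D)]
    exact (measurable_transcriptOf A).comp (measurable_fst.prodMk h)
  set law : (X → ℕ) → Ω → Measure (RoundState X k) := fun D ω =>
    chainLaw (E := RoundState X) μ (Fin.elim0, (U none 0 0, 0))
      (fun t e z => roundStep U B A ω t e (analystAnswer B T A D ω t e z)) k with hlaw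
  set S' : Ω → Set (RoundState X k) := fun ω => {e | transcriptOf A (ω, e.1) ∈ S} with hS'
  have hS'meas : ∀ ω, MeasurableSet (S' ω) := fun ω =>
    hS.preimage ((measurable_transcriptOf A).comp (measurable_const.prodMk measurable_fst))
  have hsection : ∀ D, coinLaw P k b {c | onlineMechanism U B T k A D c ∈ S}
      = ∫⁻ ω, law D ω (S' ω) ∂P := by
    intro D
    have hset : MeasurableSet {c | onlineMechanism U B T k A D c ∈ S} := hS.preimage (hmeas D)
    rw [coinLaw, Measure.prod_apply hset]
    refine lintegral_congr fun ω => ?_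
    rw [hlaw]
    simp only
    rw [← map_interaction_eq_chainLaw hU B hT.le A D ω μ k, Measure.map_apply _ (hS'meas ω)]
    · congr 1
      ext z
      simp only [Set.mem_preimage, Set.mem_ofPred_eq, onlineMechanism_eq_transcriptOf, hS']
    · exact (measurable_interaction hU B hT.le A D k).comp
        (measurable_const.prodMk measurable_zeroExtend)
  have hpriv : ∀ ω, law D ω (S' ω)
      ≤ ENNReal.ofReal (Real.exp ε) * law D' ω (S' ω) + ENNReal.ofReal δ := by
    intro ω
    set ℓ : ∀ t, RoundState X t → RoundAnswer → ℝ := fun t e y =>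
      if B ≤ e.2.2 then 0 else
        roundLoss b T (queryValue (A.ask t (ω, e.1)) e.2.1)
          (queryValue (A.ask t (ω, e.1)) (realHistogram D))
          (queryValue (A.ask t (ω, e.1)) (realHistogram D')) (answerValue y) with hℓ
    have hask : ∀ t, Measurable fun p : RoundState X t × RoundAnswer => A.ask t (ω, p.1.1) :=
      fun t => (A.measurable_ask t).comp (measurable_const.prodMk measurable_fst.fst)
    refine (chainLaw_apply_le (μ := μ) (ℓ := ℓ) (E := RoundState X) (lam := lam) (κ := κ)
      (step := roundStep U B A ω)
      (ans := analystAnswer B T A D ω) (ans' := analystAnswer B T A D' ω)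
      -- The truncation at `B` bounds `N` in all states, not only in the reachable ones.
      (N := fun t e => ((min e.2.2 B : ℕ) : ℝ)) (B := B)
      (fun t => measurable_roundStep hU B A t measurable_const measurable_fst measurable_snd)
      (fun t => measurable_analystAnswer B T A D t measurable_const measurable_fst measurable_snd)
      (fun t => measurable_analystAnswer B T A D' t measurable_const measurable_fst measurable_snd)
      (fun t => ?_) (fun t e F hF => ?_) (fun t => ?_) (by simp) (fun t e => ?_) hlam hκ0
      (fun t e => ?_) ε k (hS'meas ω)).trans ?_
    · exact Measurable.ite (measurableSet_le measurable_const measurable_fst.snd.snd)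
        measurable_const (measurable_roundLoss hb0 T
          (measurable_queryValue (hask t) measurable_fst.snd.fst)
          (measurable_queryValue (hask t) measurable_const)
          (measurable_queryValue (hask t) measurable_const)
          (measurable_answerValue.comp measurable_snd))
    · by_cases hB : B ≤ e.2.2
      · simp [analystAnswer, roundAnswer, hℓ, hB]
      · have hG : Measurable fun r : ℝ => F (Sum.inr r) := hF.comp measurable_inr
        simpa [analystAnswer, roundAnswer, hℓ, hB, answerValue] using
          lintegral_thresholdAnswer_eq hb0 hT (queryValue (A.ask t (ω, e.1)) e.2.1)
          (queryValue (A.ask t (ω, e.1)) (realHistogram D))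
          (queryValue (A.ask t (ω, e.1)) (realHistogram D')) hG
    · have h1 : Measurable fun e : RoundState X t => e.2.2 := measurable_snd.snd
      exact (measurable_from_top (f := fun n : ℕ => ((min n B : ℕ) : ℝ))).comp h1
    · exact_mod_cast min_le_right _ _
    · by_cases hB : B ≤ e.2.2
      · simp [analystAnswer, roundAnswer, roundStep, stateAfter, hℓ, hB]
      · have hm := lintegral_exp_roundLoss_le hb hT hlam hle hκ hκ1
          (f := queryValue (A.ask t (ω, e.1)) e.2.1)
          (abs_queryValue_sub_le (h𝒬 _ (A.ask_mem t (ω, e.1))) hDD')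
        refine le_trans (le_of_eq (lintegral_congr fun z => ?_)) hm
        have hlt : e.2.2 < B := not_le.1 hB
        have h1 : min e.2.2 B = e.2.2 := min_eq_left hlt.le
        have h2 : min (e.2.2 + 1) B = e.2.2 + 1 := min_eq_left hlt
        simp only [analystAnswer, roundAnswer, roundStep, stateAfter, hℓ, hB, answerValue,
          if_false, Sum.elim_inr, id]
        split_ifs with h
        · simp
        · simp [h1, h2]
    · gcongr
  rw [hsection D, hsection D']
  calc ∫⁻ ω, law D ω (S' ω) ∂P
      ≤ ∫⁻ ω, (ENNReal.ofReal (Real.exp ε) * law D' ω (S' ω) + ENNReal.ofReal δ) ∂P :=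
        lintegral_mono hpriv
    _ = _ := by
        rw [lintegral_add_right _ measurable_const, lintegral_const_mul' _ _ ENNReal.ofReal_ne_top,
          lintegral_const, measure_univ, mul_one]

end Interaction

/-! ### The Frieze/Kannan mechanism -/

section FriezeKannan

variable {X : Type*} [Fintype X]

theorem measurable_fkUpdate (γ : ℝ) :
    Measurable fun p : (X → ℝ) × (X → ℝ) × ℝ => fkUpdate γ (some p.1) p.2.1 p.2.2 := by
  have hv : Measurable fun p : (X → ℝ) × (X → ℝ) × ℝ => queryValue p.2.1 p.1 - p.2.2 :=
    (measurable_queryValue measurable_snd.fst measurable_fst).sub measurable_snd.snd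
  have hq : Measurable fun p : (X → ℝ) × (X → ℝ) × ℝ => (γ / Fintype.card X) • p.2.1 :=
    (measurable_const_smul _).comp measurable_snd.fst
  unfold fkUpdate
  exact Measurable.ite (measurableSet_lt measurable_const hv) (measurable_fst.sub hq)
    (Measurable.ite (measurableSet_lt hv measurable_const) (measurable_fst.add hq) measurable_fst)

theorem sum_sq_add_mul (a q : X → ℝ) (c : ℝ) :
    ∑ x, (a x + c * q x) ^ 2 = ∑ x, a x ^ 2 + 2 * c * ∑ x, q x * a x + c ^ 2 * ∑ x, q x ^ 2 := by
  rw [Finset.mul_sum, Finset.mul_sum, ← Finset.sum_add_distrib, ← Finset.sum_add_distrib]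
  exact Finset.sum_congr rfl fun x _ => by ring

theorem sum_sq_le_card {q : X → ℝ} (hq : IsLinearQuery q) : ∑ x, q x ^ 2 ≤ Fintype.card X := by
  have h : ∀ x ∈ Finset.univ, q x ^ 2 ≤ 1 := fun x _ => pow_le_one₀ (hq x).1 (hq x).2
  simpa using Finset.sum_le_card_nsmul Finset.univ _ _ h

theorem queryValue_sub (q D D' : X → ℝ) :
    queryValue q D - queryValue q D' = ∑ x, q x * (D x - D' x) := by
  unfold queryValue
  rw [← Finset.sum_sub_distrib]
  exact Finset.sum_congr rfl fun x _ => by ring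

/-- An update lowers the squared distance to the true database by more than `γ² / |X|` if the
current error exceeds `γ` and the noise is too small to obscure its sign. -/
theorem sum_sq_fkUpdate_sub_lt [Nonempty X] {γ T : ℝ} (hγ : 0 < γ) (hγT : γ ≤ 3 / 4 * T)
    {q : X → ℝ} (hq : IsLinearQuery q) {D Dt : X → ℝ} {z : ℝ} (hz : |z| ≤ T / 4)
    (h : T < |queryValue q D + z - queryValue q Dt|) :
    ∑ x, (fkUpdate γ (some Dt) q (queryValue q D + z) x - D x) ^ 2
      < ∑ x, (Dt x - D x) ^ 2 - γ ^ 2 / Fintype.card X := by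
  have hn : (0 : ℝ) < Fintype.card X := by exact_mod_cast Fintype.card_pos
  have hsub := queryValue_sub q Dt D
  have hsq := sum_sq_le_card hq
  rw [abs_le] at hz
  have hgain : ∀ d : ℝ, γ < d → -(2 * (γ / Fintype.card X) * d)
      + (γ / Fintype.card X) ^ 2 * ∑ x, q x ^ 2 < -(γ ^ 2 / Fintype.card X) := by
    intro d hd
    have h1 : (γ / Fintype.card X) ^ 2 * ∑ x, q x ^ 2 ≤ γ ^ 2 / Fintype.card X := by
      calc _ ≤ (γ / Fintype.card X) ^ 2 * (Fintype.card X : ℝ) := by gcongr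
        _ = _ := by field_simp
    have h2 : γ / Fintype.card X * γ < γ / Fintype.card X * d :=
      mul_lt_mul_of_pos_left hd (by positivity)
    have h3 : γ / Fintype.card X * γ = γ ^ 2 / Fintype.card X := by ring
    linarith
  rcases lt_abs.1 h with h | h
  · have hlt : queryValue q Dt - (queryValue q D + z) < 0 := by linarith
    have hupd : ∀ x, fkUpdate γ (some Dt) q (queryValue q D + z) x - D x
        = (Dt x - D x) + γ / Fintype.card X * q x := by
      intro x
      simp only [fkUpdate, if_neg hlt.le.not_gt, if_pos hlt, Pi.add_apply, Pi.smul_apply,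
        smul_eq_mul]
      ring
    simp only [hupd]
    rw [sum_sq_add_mul, ← hsub]
    have := hgain (queryValue q D - queryValue q Dt) (by linarith)
    linarith
  · have hlt : 0 < queryValue q Dt - (queryValue q D + z) := by linarith
    have hupd : ∀ x, fkUpdate γ (some Dt) q (queryValue q D + z) x - D x
        = (Dt x - D x) + -(γ / Fintype.card X) * q x := by
      intro x
      simp only [fkUpdate, if_pos hlt, Pi.sub_apply, Pi.smul_apply, smul_eq_mul]
      ring
    simp only [hupd]
    rw [sum_sq_add_mul, ← hsub]
    have := hgain (queryValue q Dt - queryValue q D) (by linarith)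
    linarith

/-- The potential argument: while the noise is small, `C` updates have lowered the squared distance
to the true database by at least `C γ² / |X|`, and by more if there has been an update. -/
theorem fk_interaction_potential [Nonempty X] {Ω : Type*} [MeasurableSpace Ω]
    {𝒬 : Set (X → ℝ)} (h𝒬 : ∀ q ∈ 𝒬, IsLinearQuery q) {γ T : ℝ} (hγ : 0 < γ)
    (hγT : γ ≤ 3 / 4 * T) (B : ℕ) (A : Analyst Ω 𝒬) {D : X → ℕ} {n₂ : ℕ}
    (hD : ∑ x, D x ^ 2 ≤ n₂) (ω : Ω) {z : ℕ → ℝ} (hz : ∀ i, |z i| ≤ T / 4) (t : ℕ) :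
    let s := (interaction (fkUpdate γ) B T A D ω z t).2
    ∑ x, (s.1 x - realHistogram D x) ^ 2 + s.2 * (γ ^ 2 / Fintype.card X) ≤ n₂ ∧
      (s.2 ≠ 0 →
        ∑ x, (s.1 x - realHistogram D x) ^ 2 + s.2 * (γ ^ 2 / Fintype.card X) < n₂) := by
  induction t with
  | zero =>
    simp only [interaction, fkUpdate, Pi.zero_apply, zero_sub, neg_sq, realHistogram, ne_eq,
      not_true_eq_false, false_imp_iff, and_true, Nat.cast_zero, zero_mul, add_zero]
    exact_mod_cast hD
  | succ t ih =>
    set e := interaction (fkUpdate γ) B T A D ω z t with he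
    have hstep : (interaction (fkUpdate γ) B T A D ω z (t + 1)).2
        = (mechanismRound (fkUpdate γ) B T D (A.ask t (ω, e.1)) (z t) e.2).2 := rfl
    simp only [hstep]
    unfold mechanismRound
    simp only
    split_ifs with h1 h2
    · exact ih
    · exact ih
    · have hlt := sum_sq_fkUpdate_sub_lt hγ hγT (h𝒬 _ (A.ask_mem t (ω, e.1))) (hz t)
        (not_le.1 h2)
      have hstrict : ∑ x, (fkUpdate γ (some e.2.1) (A.ask t (ω, e.1))
          (queryValue (A.ask t (ω, e.1)) (realHistogram D) + z t) x - realHistogram D x) ^ 2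
            + ((e.2.2 + 1 : ℕ) : ℝ) * (γ ^ 2 / Fintype.card X) < n₂ := by
        have := ih.1
        push_cast
        linarith
      exact ⟨hstrict.le, fun _ => hstrict⟩

theorem abs_queryValue_sub_le_sqrt {q D D' : X → ℝ} (hq : IsLinearQuery q) {a : ℝ}
    (h : ∑ x, (D' x - D x) ^ 2 ≤ a) :
    |queryValue q D - queryValue q D'| ≤ Real.sqrt (a * Fintype.card X) := by
  have h0 : (0 : ℝ) ≤ ∑ x, (D' x - D x) ^ 2 := Finset.sum_nonneg fun x _ => sq_nonneg _
  rw [abs_sub_comm, queryValue_sub]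
  apply Real.abs_le_sqrt
  calc _ ≤ (∑ x, q x ^ 2) * ∑ x, (D' x - D x) ^ 2 := Finset.sum_mul_sq_le_sq_mul_sq _ _ _
    _ ≤ Fintype.card X * a := mul_le_mul (sum_sq_le_card hq) h h0 (Nat.cast_nonneg _)
    _ = _ := mul_comm _ _

/-- While the noise is small every query is answered, with error at most `3 γ`. If `γ` exceeds
`√(n₂ |X|)`, the a priori bound on the value of a query, then no update ever takes place and the
fake answers are accurate for that reason; otherwise the threshold is comparable to `γ`. -/
theorem fk_answersAccurate [Nonempty X] {Ω : Type*} [MeasurableSpace Ω]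
    {𝒬 : Set (X → ℝ)} (h𝒬 : ∀ q ∈ 𝒬, IsLinearQuery q) {γ T : ℝ} (hγ : 0 < γ)
    (hγT : γ ≤ 3 / 4 * T) {n₂ : ℕ} (hn₂ : 1 ≤ n₂)
    (hTγ : γ < Real.sqrt ((n₂ : ℝ) * Fintype.card X) → 5 / 4 * T ≤ 3 * γ)
    (A : Analyst Ω 𝒬) {D : X → ℕ} (hD : ∑ x, D x ^ 2 ≤ n₂) {k : ℕ} {c : Ω × (Fin k → ℝ)}
    (hc : ∀ i, |c.2 i| ≤ T / 4) :
    AnswersAccurate (3 * γ) D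
      (onlineMechanism (fkUpdate γ) (fkBound X n₂ γ) T k A D c).2 := by
  intro t
  have hn : (0 : ℝ) < Fintype.card X := by exact_mod_cast Fintype.card_pos
  have hn₂' : (0 : ℝ) < n₂ := by exact_mod_cast hn₂
  have hz : ∀ i, |zeroExtend c.2 i| ≤ T / 4 := by
    intro i
    unfold zeroExtend
    split_ifs with h
    · exact hc _
    · rw [abs_zero]; linarith
  have hpot := fk_interaction_potential h𝒬 hγ hγT (fkBound X n₂ γ) A hD c.1 hz t
  set e := interaction (fkUpdate γ) (fkBound X n₂ γ) T A D c.1 (zeroExtend c.2) t with he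
  set q := A.ask t (c.1, e.1) with hqdef
  have hq : IsLinearQuery q := h𝒬 _ (A.ask_mem t (c.1, e.1))
  simp only at hpot
  have hsum0 : 0 ≤ ∑ x, (e.2.1 x - realHistogram D x) ^ 2 :=
    Finset.sum_nonneg fun x _ => sq_nonneg _
  have hpos : 0 < γ ^ 2 / (Fintype.card X : ℝ) := by positivity
  -- Strictness in the potential argument is needed here: `B` may be exactly `n₂ |X| / γ²`.
  have halive : ¬ fkBound X n₂ γ ≤ e.2.2 := by
    intro hle
    have hB : (n₂ : ℝ) * Fintype.card X / γ ^ 2 ≤ e.2.2 :=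
      (Nat.le_ceil _).trans (Nat.cast_le.2 hle)
    have hne : e.2.2 ≠ 0 := by
      rintro h0
      rw [h0, Nat.cast_zero] at hB
      have : 0 < (n₂ : ℝ) * Fintype.card X / γ ^ 2 := by positivity
      linarith
    have h1 := hpot.2 hne
    have h2 : (n₂ : ℝ) * Fintype.card X / γ ^ 2 * (γ ^ 2 / Fintype.card X)
        ≤ e.2.2 * (γ ^ 2 / Fintype.card X) := mul_le_mul_of_nonneg_right hB hpos.le
    have h3 : (n₂ : ℝ) * Fintype.card X / γ ^ 2 * (γ ^ 2 / Fintype.card X) = n₂ := by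
      field_simp
    linarith
  have hdist : |queryValue q (realHistogram D) - queryValue q e.2.1|
      ≤ Real.sqrt ((n₂ : ℝ) * Fintype.card X) := by
    apply abs_queryValue_sub_le_sqrt hq
    have : 0 ≤ (e.2.2 : ℝ) * (γ ^ 2 / Fintype.card X) := by positivity
    linarith [hpot.1]
  have hzt := abs_le.1 (hz t)
  change ∃ a, (mechanismRound (fkUpdate γ) (fkBound X n₂ γ) T D q (zeroExtend c.2 t) e.2).1
    = Sum.inr a ∧ |queryValue q (realHistogram D) - a| ≤ 3 * γ
  unfold mechanismRound
  simp only [if_neg halive]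
  split_ifs with h
  · refine ⟨_, rfl, ?_⟩
    rcases lt_or_ge γ (Real.sqrt ((n₂ : ℝ) * Fintype.card X)) with hlt | hge
    · refine le_trans ?_ (hTγ hlt)
      rw [abs_le] at h ⊢
      constructor <;> linarith [h.1, h.2]
    · linarith
  · refine ⟨_, rfl, ?_⟩
    have hlt : γ < Real.sqrt ((n₂ : ℝ) * Fintype.card X) := by
      refine lt_of_lt_of_le ?_ hdist
      rw [lt_abs]
      rcases lt_abs.1 (not_le.1 h) with h | h
      · exact Or.inl (by linarith)
      · exact Or.inr (by linarith)
    refine le_trans ?_ (hTγ hlt)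
    rw [abs_le]
    constructor <;> linarith [hzt.1, hzt.2]

end FriezeKannan

theorem one_le_log_four_div {δ : ℝ} (hδ : 0 < δ) (hδ1 : δ ≤ 1) : 1 ≤ Real.log (4 / δ) := by
  have h1 : Real.log 4 ≤ Real.log (4 / δ) :=
    Real.log_le_log (by norm_num) (by rw [le_div_iff₀ hδ]; linarith)
  have h2 : Real.log 4 = 2 * Real.log 2 := by
    rw [show (4 : ℝ) = 2 ^ 2 by norm_num, Real.log_pow]
    norm_num
  linarith [Real.log_two_gt_d9]

theorem log_two_mul_div_pos {k : ℕ} {β : ℝ} (hk : 1 ≤ k) (hβ : 0 < β) (hβ1 : β ≤ 1) :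
    0 < Real.log (2 * k / β) := by
  have hk' : (1 : ℝ) ≤ k := by exact_mod_cast hk
  exact Real.log_pos (by rw [lt_div_iff₀ hβ]; linarith)

/-- All noise values are at most `s` in absolute value, up to the union bound. -/
theorem coinLaw_abs_le {Ω : Type*} [MeasurableSpace Ω] (P : Measure Ω) [IsProbabilityMeasure P]
    (k : ℕ) {b s : ℝ} (hb : 0 < b) (hs : 0 ≤ s) :
    ENNReal.ofReal (1 - k * Real.exp (-s / b)) ≤ coinLaw P k b {c | ∀ i, |c.2 i| ≤ s} := by
  have := isProbabilityMeasure_laplaceDistribution hb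
  have hbad : ∀ i : Fin k, coinLaw P k b {c | s < |c.2 i|}
      = ENNReal.ofReal (Real.exp (-s / b)) := by
    intro i
    have hm : MeasurableSet {z : ℝ | s < |z|} := measurableSet_lt measurable_const (by fun_prop)
    rw [← laplaceDistribution_tail hb hs]
    have hmp := (measurePreserving_eval (fun _ : Fin k => laplaceDistribution b) i).comp
      (measurePreserving_snd (μ := P) (ν := Measure.pi fun _ : Fin k => laplaceDistribution b))
    exact hmp.measure_preimage hm.nullMeasurableSet
  have hmeas : MeasurableSet {c : Ω × (Fin k → ℝ) | ∀ i, |c.2 i| ≤ s} := by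
    have : {c : Ω × (Fin k → ℝ) | ∀ i, |c.2 i| ≤ s} = ⋂ i, {c | |c.2 i| ≤ s} := by ext; simp
    rw [this]
    exact MeasurableSet.iInter fun i =>
      measurableSet_le (by fun_prop) measurable_const
  have hprob : IsProbabilityMeasure (coinLaw P k b) := by unfold coinLaw; infer_instance
  have hcompl : coinLaw P k b {c | ∀ i, |c.2 i| ≤ s}ᶜ
      ≤ ENNReal.ofReal (k * Real.exp (-s / b)) := by
    have hsub : {c : Ω × (Fin k → ℝ) | ∀ i, |c.2 i| ≤ s}ᶜ ⊆ ⋃ i, {c | s < |c.2 i|} := by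
      intro c hc
      simpa using hc
    refine (measure_mono hsub).trans ((measure_iUnion_fintype_le _ _).trans ?_)
    simp only [hbad]
    rw [Finset.sum_const, Finset.card_univ, Fintype.card_fin, nsmul_eq_mul,
      ENNReal.ofReal_mul (Nat.cast_nonneg k), ENNReal.ofReal_natCast]
  rw [ENNReal.ofReal_sub _ (by positivity), ENNReal.ofReal_one, tsub_le_iff_right]
  calc (1 : ENNReal) = coinLaw P k b {c | ∀ i, |c.2 i| ≤ s}
        + coinLaw P k b {c | ∀ i, |c.2 i| ≤ s}ᶜ := (prob_add_prob_compl hmeas).symm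
    _ ≤ _ := by gcongr

section Parameters

variable (X : Type*) [Fintype X] [Nonempty X] {n₂ k : ℕ} {ε δ β : ℝ}

theorem sqrt_mul_card_pos (hn₂ : 1 ≤ n₂) : 0 < Real.sqrt ((n₂ : ℝ) * Fintype.card X) := by
  have hn : (0 : ℝ) < Fintype.card X := by exact_mod_cast Fintype.card_pos
  have hn₂' : (0 : ℝ) < n₂ := by exact_mod_cast hn₂
  exact Real.sqrt_pos.2 (by positivity)

theorem fkGamma_pos (hn₂ : 1 ≤ n₂) (hk : 1 ≤ k) (hε : 0 < ε) (hδ : 0 < δ) (hδ1 : δ ≤ 1)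
    (hβ : 0 < β) (hβ1 : β ≤ 1) : 0 < fkGamma X n₂ ε δ β k := by
  have h1 := sqrt_mul_card_pos X hn₂
  have h2 : 0 < Real.log (4 / δ) := by linarith [one_le_log_four_div hδ hδ1]
  have h3 := log_two_mul_div_pos hk hβ hβ1
  exact Real.sqrt_pos.2 (by positivity)

theorem one_le_fkMaxUpdates (hn₂ : 1 ≤ n₂) (hk : 1 ≤ k) (hε : 0 < ε) (hδ : 0 < δ) (hδ1 : δ ≤ 1)
    (hβ : 0 < β) (hβ1 : β ≤ 1) : 1 ≤ fkMaxUpdates X n₂ ε δ β k := by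
  have hγ := fkGamma_pos X hn₂ hk hε hδ hδ1 hβ hβ1
  have hn : (0 : ℝ) < Fintype.card X := by exact_mod_cast Fintype.card_pos
  have hn₂' : (0 : ℝ) < n₂ := by exact_mod_cast hn₂
  exact Nat.ceil_pos.2 (by positivity)

theorem noiseScale_ge {B : ℕ} (hB : 1 ≤ B) (hε : 0 < ε) (hε1 : ε ≤ 1) (hδ : 0 < δ)
    (hδ1 : δ ≤ 1) : 1000 ≤ noiseScale B ε δ := by
  have h2 := one_le_log_four_div hδ hδ1
  have hs : 1 ≤ Real.sqrt B := Real.one_le_sqrt.2 (by exact_mod_cast hB)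
  unfold noiseScale
  rw [le_div_iff₀ hε]
  have : 1 ≤ Real.sqrt B * Real.log (4 / δ) := one_le_mul_of_one_le_of_one_le hs h2
  linarith

/-- `γ` was chosen as `3 T / 4` for the bound on the number of updates before rounding. -/
theorem fkGamma_le_and_le (hn₂ : 1 ≤ n₂) (hk : 1 ≤ k) (hε : 0 < ε) (hδ : 0 < δ) (hδ1 : δ ≤ 1)
    (hβ : 0 < β) (hβ1 : β ≤ 1) :
    fkGamma X n₂ ε δ β k ≤ 3 / 4 * updateThreshold (fkMaxUpdates X n₂ ε δ β k) ε δ β k ∧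
      (fkGamma X n₂ ε δ β k < Real.sqrt ((n₂ : ℝ) * Fintype.card X) →
        5 / 4 * updateThreshold (fkMaxUpdates X n₂ ε δ β k) ε δ β k
          ≤ 3 * fkGamma X n₂ ε δ β k) := by
  have hγ := fkGamma_pos X hn₂ hk hε hδ hδ1 hβ hβ1
  have hN := sqrt_mul_card_pos X hn₂
  have hL : 0 < Real.log (4 / δ) := by linarith [one_le_log_four_div hδ hδ1]
  have hl := log_two_mul_div_pos hk hβ hβ1
  set γ := fkGamma X n₂ ε δ β k with hγdef
  set B := fkMaxUpdates X n₂ ε δ β k with hBdef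
  set N := Real.sqrt ((n₂ : ℝ) * Fintype.card X) with hNdef
  have hN2 : N ^ 2 = (n₂ : ℝ) * Fintype.card X := Real.sq_sqrt (by positivity)
  have hγ2 : γ ^ 2 = 3000 * N * Real.log (4 / δ) * Real.log (2 * k / β) / ε :=
    Real.sq_sqrt (by positivity)
  -- Without rounding, `√B` would be `N / γ`, so the deviation of `√B γ` from `N` measures the effect
  -- of rounding.
  have hT : updateThreshold B ε δ β k = 4 / 3 * (Real.sqrt B * γ) * γ / N := by
    rw [show 4 / 3 * (Real.sqrt B * γ) * γ / N = 4 / 3 * Real.sqrt B * γ ^ 2 / N by ring, hγ2]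
    unfold updateThreshold noiseScale
    field_simp
    ring
  have hBlow : N ^ 2 ≤ B * γ ^ 2 := by
    rw [← div_le_iff₀ (by positivity), hN2]
    exact Nat.le_ceil _
  have hBup : (B : ℝ) * γ ^ 2 < N ^ 2 + γ ^ 2 := by
    have h1 : (B : ℝ) < N ^ 2 / γ ^ 2 + 1 := by
      rw [hN2]
      exact Nat.ceil_lt_add_one (by positivity)
    calc (B : ℝ) * γ ^ 2 < (N ^ 2 / γ ^ 2 + 1) * γ ^ 2 := mul_lt_mul_of_pos_right h1 (by positivity)
      _ = _ := by field_simp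
  have hsq : (Real.sqrt B * γ) ^ 2 = B * γ ^ 2 := by
    rw [mul_pow, Real.sq_sqrt (Nat.cast_nonneg _)]
  rw [hT]
  constructor
  · have h1 : N ≤ Real.sqrt B * γ := by
      rw [← hsq] at hBlow
      exact (pow_le_pow_iff_left₀ hN.le (by positivity) two_ne_zero).1 hBlow
    rw [show 3 / 4 * (4 / 3 * (Real.sqrt B * γ) * γ / N) = Real.sqrt B * γ * γ / N by ring,
      le_div_iff₀ hN, mul_comm]
    gcongr
  · intro hlt
    have h1 : Real.sqrt B * γ ≤ 3 / 2 * N := by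
      refine (pow_le_pow_iff_left₀ (by positivity) (by positivity) two_ne_zero).1 ?_
      have : γ ^ 2 ≤ N ^ 2 := pow_le_pow_left₀ hγ.le hlt.le 2
      rw [hsq]
      nlinarith
    calc 5 / 4 * (4 / 3 * (Real.sqrt B * γ) * γ / N)
        ≤ 5 / 4 * (4 / 3 * (3 / 2 * N) * γ / N) := by gcongr
      _ = 5 / 2 * γ := by field_simp
      _ ≤ 3 * γ := by linarith

theorem fkGamma_le (hn₂ : 1 ≤ n₂) (hε : 0 < ε) (hδ : 0 < δ) (hδ1 : δ ≤ 1 / 2)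
    (hβ : 0 < β) (hkβ : 2 * β ≤ k) :
    3 * fkGamma X n₂ ε δ β k ≤ 405 * ((n₂ : ℝ) ^ (1 / 4 : ℝ) * (Fintype.card X : ℝ) ^ (1 / 4 : ℝ)
      * Real.sqrt (Real.log (k / β) * Real.log (1 / δ)) / Real.sqrt ε) := by
  have hN := sqrt_mul_card_pos X hn₂
  have hk : (0 : ℝ) < k := by linarith
  have h2 := Real.log_two_gt_d9
  have hL : Real.log (4 / δ) ≤ 3 * Real.log (1 / δ) := by
    have h4 : Real.log (4 / δ) = 2 * Real.log 2 + Real.log (1 / δ) := by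
      rw [show 4 / δ = 2 ^ 2 * (1 / δ) by ring, Real.log_mul (by norm_num) (by positivity),
        Real.log_pow]
      norm_num
    have : Real.log 2 ≤ Real.log (1 / δ) :=
      Real.log_le_log two_pos (by rw [le_div_iff₀ hδ]; linarith)
    linarith
  have hlog2 : Real.log 2 ≤ Real.log (k / β) :=
    Real.log_le_log two_pos (by rwa [le_div_iff₀ hβ])
  have hl : Real.log (2 * k / β) ≤ 2 * Real.log (k / β) := by
    have : Real.log (2 * k / β) = Real.log 2 + Real.log (k / β) := by
      rw [mul_div_assoc, Real.log_mul (by norm_num) (by positivity)]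
    linarith
  have hLpos : 0 ≤ Real.log (1 / δ) := by
    linarith [one_le_log_four_div hδ (by linarith)]
  have hlpos : 0 ≤ Real.log (k / β) := by linarith
  have hroot : (n₂ : ℝ) ^ (1 / 4 : ℝ) * (Fintype.card X : ℝ) ^ (1 / 4 : ℝ)
      = Real.sqrt (Real.sqrt ((n₂ : ℝ) * Fintype.card X)) := by
    rw [← Real.mul_rpow (Nat.cast_nonneg _) (Nat.cast_nonneg _), Real.sqrt_eq_rpow,
      Real.sqrt_eq_rpow, ← Real.rpow_mul (by positivity)]
    norm_num
  -- `135 ^ 2` exceeds `3000 · 3 · 2`, and `405 = 3 · 135`.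
  have hmain : fkGamma X n₂ ε δ β k ≤ Real.sqrt (135 ^ 2
      * (Real.sqrt ((n₂ : ℝ) * Fintype.card X) * (Real.log (k / β) * Real.log (1 / δ)) / ε)) := by
    unfold fkGamma
    apply Real.sqrt_le_sqrt
    have hprod : Real.log (4 / δ) * Real.log (2 * k / β)
        ≤ (3 * Real.log (1 / δ)) * (2 * Real.log (k / β)) := by
      refine mul_le_mul hL hl ?_ (by positivity)
      exact Real.log_nonneg (by rw [le_div_iff₀ hβ]; linarith)
    calc 3000 * Real.sqrt ((n₂ : ℝ) * Fintype.card X) * Real.log (4 / δ) * Real.log (2 * k / β) / ε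
        = 3000 * (Real.sqrt ((n₂ : ℝ) * Fintype.card X)
          * (Real.log (4 / δ) * Real.log (2 * k / β)) / ε) := by ring
      _ ≤ 3000 * (Real.sqrt ((n₂ : ℝ) * Fintype.card X)
          * ((3 * Real.log (1 / δ)) * (2 * Real.log (k / β))) / ε) := by gcongr
      _ = 18000 * (Real.sqrt ((n₂ : ℝ) * Fintype.card X)
          * (Real.log (k / β) * Real.log (1 / δ)) / ε) := by ring
      _ ≤ _ := by
          refine mul_le_mul_of_nonneg_right (by norm_num) (by positivity)
  rw [Real.sqrt_mul (by norm_num), Real.sqrt_sq (by norm_num), Real.sqrt_div (by positivity),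
    Real.sqrt_mul hN.le] at hmain
  rw [hroot]
  linarith

end Parameters

theorem fkMechanism_isDifferentiallyPrivate {X : Type*} [Fintype X] [Nonempty X]
    {𝒬 : Set (X → ℝ)} (h𝒬 : ∀ q ∈ 𝒬, IsLinearQuery q) {Ω : Type*} [MeasurableSpace Ω]
    (P : Measure Ω) [IsProbabilityMeasure P] (A : Analyst Ω 𝒬) {n₂ k : ℕ} {ε δ β : ℝ}
    (hn₂ : 1 ≤ n₂) (hk : 1 ≤ k) (hε : 0 < ε) (hε1 : ε ≤ 1) (hδ : 0 < δ) (hδ1 : δ ≤ 1)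
    (hβ : 0 < β) (hβ1 : β ≤ 1) :
    IsDifferentiallyPrivate ε δ (fkCoinLaw X P n₂ ε δ β k) (fkMechanism n₂ ε δ β k A) := by
  have hγ := fkGamma_pos X hn₂ hk hε hδ hδ1 hβ hβ1
  have hB := one_le_fkMaxUpdates X hn₂ hk hε hδ hδ1 hβ hβ1
  have hγT := (fkGamma_le_and_le X hn₂ hk hε hδ hδ1 hβ hβ1).1
  have hL := one_le_log_four_div hδ hδ1
  set B := fkMaxUpdates X n₂ ε δ β k with hBdef
  have hb := noiseScale_ge hB hε hε1 hδ hδ1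
  have hB' : (1 : ℝ) ≤ B := by exact_mod_cast hB
  have hs : 1 ≤ Real.sqrt B := Real.one_le_sqrt.2 hB'
  set L := Real.log (4 / δ) with hLdef
  have hratio : L / ε * (1 / noiseScale B ε δ) = 1 / (1000 * Real.sqrt B) := by
    unfold noiseScale
    rw [← hLdef]
    field_simp
  have hlam1 : 1 ≤ L / ε := by rw [le_div_iff₀ hε]; linarith
  have hκ : 10 * (L / ε + (L / ε) ^ 2) * (1 / noiseScale B ε δ) ^ 2 ≤ 20 / 1000000 / B := by
    calc 10 * (L / ε + (L / ε) ^ 2) * (1 / noiseScale B ε δ) ^ 2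
        ≤ 10 * ((L / ε) ^ 2 + (L / ε) ^ 2) * (1 / noiseScale B ε δ) ^ 2 := by
          gcongr
          exact le_self_pow₀ hlam1 two_ne_zero
      _ = 20 * (L / ε * (1 / noiseScale B ε δ)) ^ 2 := by ring
      _ = 20 / 1000000 / B := by
          rw [hratio, div_pow, mul_pow, Real.sq_sqrt (Nat.cast_nonneg _)]
          field_simp
          norm_num
  refine onlineMechanism_isDifferentiallyPrivate (measurable_fkUpdate _) B (lam := L / ε)
    (T := updateThreshold B ε δ β k) (b := noiseScale B ε δ)
    (by linarith) (by linarith) (by linarith) ?_ rfl ?_ h𝒬 P k A ?_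
  · rw [hratio, div_le_div_iff₀ (by positivity) two_pos]
    linarith
  · refine hκ.trans ?_
    rw [div_le_iff₀ (by linarith)]
    linarith
  · have h1 : 10 * (L / ε + (L / ε) ^ 2) * (1 / noiseScale B ε δ) ^ 2 * B ≤ Real.log 4 := by
      have h2 : 10 * (L / ε + (L / ε) ^ 2) * (1 / noiseScale B ε δ) ^ 2 * B
          ≤ 20 / 1000000 / B * B := by gcongr
      rw [div_mul_cancel₀ _ (by linarith)] at h2
      have h4 := one_le_log_four_div one_pos le_rfl
      rw [div_one] at h4
      linarith
    rw [div_mul_cancel₀ _ hε.ne', ← Real.le_log_iff_exp_le hδ]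
    have h3 : L = Real.log 4 - Real.log δ := Real.log_div (by norm_num) hδ.ne'
    linarith

theorem fkMechanism_answersAccurate {X : Type*} [Fintype X] [Nonempty X]
    {𝒬 : Set (X → ℝ)} (h𝒬 : ∀ q ∈ 𝒬, IsLinearQuery q) {Ω : Type*} [MeasurableSpace Ω]
    (P : Measure Ω) [IsProbabilityMeasure P] (A : Analyst Ω 𝒬) {n₂ k : ℕ} {ε δ β : ℝ}
    (hn₂ : 1 ≤ n₂) (hk : 1 ≤ k) (hε : 0 < ε) (hε1 : ε ≤ 1) (hδ : 0 < δ) (hδ1 : δ ≤ 1 / 2)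
    (hβ : 0 < β) (hβ1 : β ≤ 1) (hkβ : 2 * β ≤ k) {D : X → ℕ} (hD : ∑ x, D x ^ 2 ≤ n₂) :
    ENNReal.ofReal (1 - β) ≤ fkCoinLaw X P n₂ ε δ β k
      {c | AnswersAccurate (405 * ((n₂ : ℝ) ^ (1 / 4 : ℝ) * (Fintype.card X : ℝ) ^ (1 / 4 : ℝ)
          * Real.sqrt (Real.log (k / β) * Real.log (1 / δ)) / Real.sqrt ε))
        D (fkMechanism n₂ ε δ β k A D c).2} := by
  have hδ1' : δ ≤ 1 := by linarith
  have hγ := fkGamma_pos X hn₂ hk hε hδ hδ1' hβ hβ1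
  have hB := one_le_fkMaxUpdates X hn₂ hk hε hδ hδ1' hβ hβ1
  obtain ⟨hγT, hTγ⟩ := fkGamma_le_and_le X hn₂ hk hε hδ hδ1' hβ hβ1
  have hb := noiseScale_ge hB hε hε1 hδ hδ1'
  have hk' : (0 : ℝ) < k := by exact_mod_cast hk
  set B := fkMaxUpdates X n₂ ε δ β k with hBdef
  set T := updateThreshold B ε δ β k with hTdef
  have hgood := coinLaw_abs_le P k (b := noiseScale B ε δ) (s := T / 4) (by linarith)
    (by linarith)
  have htail : (k : ℝ) * Real.exp (-(T / 4) / noiseScale B ε δ) = β / 2 := by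
    have h1 : -(T / 4) / noiseScale B ε δ = -Real.log (2 * k / β) := by
      have : noiseScale B ε δ ≠ 0 := by linarith
      rw [hTdef, updateThreshold]
      field_simp
    rw [h1, Real.exp_neg, Real.exp_log (by positivity)]
    field_simp
  rw [htail] at hgood
  refine (ENNReal.ofReal_le_ofReal (by linarith)).trans (hgood.trans (measure_mono ?_))
  intro c hc t
  obtain ⟨a, ha, hacc⟩ := fk_answersAccurate h𝒬 hγ hγT hn₂ hTγ A hD (c := c) hc t
  exact ⟨a, ha, hacc.trans (fkGamma_le X hn₂ hε hδ hδ1 hβ hkβ)⟩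

/-! ### Cut queries -/

section Cuts

variable {V : Type*} [DecidableEq V]

theorem isLinearQuery_cutQuery (S T : Finset V) : IsLinearQuery (cutQuery S T) := by
  intro e
  unfold cutQuery
  refine ⟨by positivity, ?_⟩
  rw [div_le_one two_pos]
  obtain ⟨e, he⟩ := e
  induction e using Sym2.ind with
  | _ x y =>
    have hsub : ((S ×ˢ T).filter fun p => s(p.1, p.2) = s(x, y)) ⊆ {(x, y), (y, x)} := by
      intro p hp
      have h := (Finset.mem_filter.1 hp).2
      rw [Sym2.eq_iff] at h
      rcases h with ⟨h1, h2⟩ | ⟨h1, h2⟩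
      · simp [Prod.ext_iff, h1, h2]
      · simp [Prod.ext_iff, h1, h2]
    exact_mod_cast (Finset.card_le_card hsub).trans Finset.card_le_two

variable [Fintype V]

theorem queryValue_cutQuery_edgeDatabase (G : SimpleGraph V) (S T : Finset V) :
    2 * queryValue (cutQuery S T) (realHistogram (edgeDatabase G)) = cutValue G S T := by
  classical
  have hcut : cutValue G S T = ∑ p ∈ S ×ˢ T, if G.Adj p.1 p.2 then (1 : ℝ) else 0 := by
    rw [cutValue, Finset.sum_product]
    refine Finset.sum_congr rfl fun i _ => Finset.sum_congr rfl fun j _ => ?_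
    rw [SimpleGraph.adjMatrix_apply]
  rw [hcut]
  unfold queryValue cutQuery realHistogram edgeDatabase
  rw [Finset.mul_sum]
  have h1 : ∀ e : PossibleEdge V,
      2 * ((((S ×ˢ T).filter fun p => s(p.1, p.2) = e.1).card : ℝ) / 2
        * ((if e.1 ∈ G.edgeSet then 1 else 0 : ℕ) : ℝ))
      = ∑ p ∈ S ×ˢ T, if s(p.1, p.2) = e.1 ∧ e.1 ∈ G.edgeSet then 1 else 0 := by
    intro e
    by_cases he : e.1 ∈ G.edgeSet
    · simp only [he, if_true, and_true, Finset.sum_boole]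
      push_cast
      ring
    · simp [he]
  simp only [h1]
  rw [Finset.sum_comm]
  refine Finset.sum_congr rfl fun p _ => ?_
  by_cases hadj : G.Adj p.1 p.2
  · have hnd : ¬ (s(p.1, p.2)).IsDiag := by simpa using hadj.ne
    rw [if_pos hadj, Finset.sum_eq_single (⟨s(p.1, p.2), hnd⟩ : PossibleEdge V)]
    · rw [if_pos ⟨rfl, by simpa using hadj⟩]
    · intro e _ hne
      rw [if_neg]
      rintro ⟨h, -⟩
      exact hne (Subtype.ext h.symm)
    · simp
  · rw [if_neg hadj]
    refine Finset.sum_eq_zero fun e _ => ?_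
    rw [if_neg]
    rintro ⟨h, he⟩
    rw [← h] at he
    exact hadj (by simpa using he)

theorem sum_edgeDatabase_sq (G : SimpleGraph V) :
    ∑ e, edgeDatabase G e ^ 2 = G.edgeSet.ncard := by
  classical
  have h1 : ∀ e : PossibleEdge V, edgeDatabase G e ^ 2 = if e.1 ∈ G.edgeSet then 1 else 0 := by
    intro e
    unfold edgeDatabase
    split_ifs <;> simp
  simp only [h1]
  rw [Finset.sum_boole, Nat.cast_id, ← Set.ncard_coe_finset]
  refine Set.ncard_congr (fun e _ => e.1) ?_ ?_ ?_
  · intro e he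
    simpa using he
  · intro e e' _ _ h
    exact Subtype.ext h
  · intro e he
    exact ⟨⟨e, G.not_isDiag_of_mem_edgeSet he⟩, by simpa using he, rfl⟩

theorem card_possibleEdge_le : Fintype.card (PossibleEdge V) ≤ Fintype.card V ^ 2 := by
  rw [Sym2.card_subtype_not_diag, Nat.choose_two_right, sq]
  exact (Nat.div_le_self _ _).trans (Nat.mul_le_mul_left _ (Nat.sub_le _ _))

instance nonempty_possibleEdge [Nontrivial V] : Nonempty (PossibleEdge V) := by
  obtain ⟨x, y, hxy⟩ := exists_pair_ne V
  exact ⟨⟨s(x, y), by simpa using hxy⟩⟩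

theorem log_two_pow_div_le {n : ℕ} (hn : 1 ≤ n) {β : ℝ} (hβ : 0 < β) (hβ1 : β ≤ 1 / 2) :
    Real.log ((2 ^ (2 * n) : ℕ) / β) ≤ 3 * n * Real.log (1 / β) := by
  have hn' : (1 : ℝ) ≤ n := by exact_mod_cast hn
  have h2 : Real.log 2 ≤ Real.log (1 / β) :=
    Real.log_le_log two_pos (by rw [le_div_iff₀ hβ]; linarith)
  have h0 : 0 < Real.log 2 := Real.log_pos one_lt_two
  have h : Real.log ((2 ^ (2 * n) : ℕ) / β) = 2 * n * Real.log 2 + Real.log (1 / β) := by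
    rw [← mul_one_div, Real.log_mul (by positivity) (by positivity)]
    push_cast
    rw [Real.log_pow]
    push_cast
    ring
  rw [h]
  nlinarith

/-- The logarithm of the number `2 ^ (2 |V|)` of queries and the size `|V| ^ 2` of the universe each
contribute a factor `√|V|` to the (doubled) error bound for linear queries. -/
theorem cut_error_le [Nontrivial V] {m : ℕ} {ε δ β : ℝ} (hδ : 0 < δ) (hδ1 : δ ≤ 1 / 2)
    (hβ : 0 < β) (hβ1 : β ≤ 1 / 2) :
    2 * (405 * ((m : ℝ) ^ (1 / 4 : ℝ) * (Fintype.card (PossibleEdge V) : ℝ) ^ (1 / 4 : ℝ)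
        * Real.sqrt (Real.log ((2 ^ (2 * Fintype.card V) : ℕ) / β) * Real.log (1 / δ))
          / Real.sqrt ε))
      ≤ 1620 * (Fintype.card V * (m : ℝ) ^ (1 / 4 : ℝ)
        * Real.sqrt (Real.log (1 / β) * Real.log (1 / δ)) / Real.sqrt ε) := by
  set n := Fintype.card V with hn
  have hn1 : 1 ≤ n := Fintype.card_pos
  have hcard : (Fintype.card (PossibleEdge V) : ℝ) ^ (1 / 4 : ℝ) ≤ Real.sqrt n := by
    have h1 : (Fintype.card (PossibleEdge V) : ℝ) ≤ (n : ℝ) ^ (2 : ℝ) := by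
      rw [Real.rpow_two]
      exact_mod_cast card_possibleEdge_le (V := V)
    calc _ ≤ ((n : ℝ) ^ (2 : ℝ)) ^ (1 / 4 : ℝ) :=
          Real.rpow_le_rpow (Nat.cast_nonneg _) h1 (by norm_num)
      _ = Real.sqrt n := by
          rw [← Real.rpow_mul (Nat.cast_nonneg _), Real.sqrt_eq_rpow]
          norm_num
  have hlδ : 0 ≤ Real.log (1 / δ) := Real.log_nonneg (by rw [le_div_iff₀ hδ]; linarith)
  have hlβ : 0 ≤ Real.log (1 / β) := Real.log_nonneg (by rw [le_div_iff₀ hβ]; linarith)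
  have hsqrt : Real.sqrt (Real.log ((2 ^ (2 * n) : ℕ) / β) * Real.log (1 / δ))
      ≤ 2 * Real.sqrt n * Real.sqrt (Real.log (1 / β) * Real.log (1 / δ)) := by
    calc _ ≤ Real.sqrt (2 ^ 2 * (n * (Real.log (1 / β) * Real.log (1 / δ)))) := by
          apply Real.sqrt_le_sqrt
          calc _ ≤ 3 * n * Real.log (1 / β) * Real.log (1 / δ) := by
                gcongr
                exact log_two_pow_div_le hn1 hβ hβ1
            _ = 3 * (n * (Real.log (1 / β) * Real.log (1 / δ))) := by ring
            _ ≤ _ := mul_le_mul_of_nonneg_right (by norm_num) (by positivity)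
      _ = _ := by
          rw [Real.sqrt_mul (by norm_num), Real.sqrt_sq (by norm_num),
            Real.sqrt_mul (Nat.cast_nonneg _), mul_assoc]
  set s := Real.sqrt (Real.log (1 / β) * Real.log (1 / δ)) with hs
  have hnn : Real.sqrt n * Real.sqrt n = n := Real.mul_self_sqrt (Nat.cast_nonneg _)
  calc _ ≤ 2 * (405 * ((m : ℝ) ^ (1 / 4 : ℝ) * Real.sqrt n * (2 * Real.sqrt n * s)
          / Real.sqrt ε)) := by gcongr
    _ = 1620 * ((Real.sqrt n * Real.sqrt n) * (m : ℝ) ^ (1 / 4 : ℝ) * s / Real.sqrt ε) := by ring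
    _ = _ := by rw [hnn]

end Cuts

theorem mainTheorem4 :
    ∃ K : ℝ, 0 < K ∧
      -- linear queries over a finite data universe
      (∀ (X : Type*) [Fintype X] [Nonempty X] (𝒬 : Set (X → ℝ)), (∀ q ∈ 𝒬, IsLinearQuery q) →
        ∀ (Ω : Type*) [MeasurableSpace Ω] (P : Measure Ω) [IsProbabilityMeasure P]
          (A : Analyst Ω 𝒬) (n₂ k : ℕ) (ε δ β : ℝ), 1 ≤ n₂ → 1 ≤ k →
          0 < ε → ε ≤ 1 → 0 < δ → δ ≤ 1 → 0 < β → β ≤ 1 →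
          IsDifferentiallyPrivate ε δ (fkCoinLaw X P n₂ ε δ β k) (fkMechanism n₂ ε δ β k A) ∧
          (δ ≤ 1 / 2 → 2 * β ≤ k → ∀ D : X → ℕ, ∑ x, D x ^ 2 ≤ n₂ →
            ENNReal.ofReal (1 - β) ≤ fkCoinLaw X P n₂ ε δ β k
              {c | AnswersAccurate
                (K * ((n₂ : ℝ) ^ (1 / 4 : ℝ) * (Fintype.card X : ℝ) ^ (1 / 4 : ℝ)
                  * Real.sqrt (Real.log (k / β) * Real.log (1 / δ)) / Real.sqrt ε))
                D (fkMechanism n₂ ε δ β k A D c).2})) ∧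
      -- all cut queries on graphs
      (∀ (V : Type*) [Fintype V] [DecidableEq V] [Nontrivial V]
        (Ω : Type*) [MeasurableSpace Ω] (P : Measure Ω) [IsProbabilityMeasure P]
          (A : Analyst Ω (cutQueries V)) (m : ℕ) (ε δ β : ℝ), 1 ≤ m →
          0 < ε → ε ≤ 1 → 0 < δ → δ ≤ 1 / 2 → 0 < β → β ≤ 1 / 2 →
          IsDifferentiallyPrivate ε δ (fkCoinLaw (PossibleEdge V) P m ε δ β (2 ^ (2 * Fintype.card V)))
            (fkMechanism m ε δ β (2 ^ (2 * Fintype.card V)) A) ∧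
          ∀ G : SimpleGraph V, G.edgeSet.ncard ≤ m →
            ENNReal.ofReal (1 - β) ≤
              fkCoinLaw (PossibleEdge V) P m ε δ β (2 ^ (2 * Fintype.card V))
              {c | CutAnswersAccurate
                (K * (Fintype.card V * (m : ℝ) ^ (1 / 4 : ℝ)
                  * Real.sqrt (Real.log (1 / β) * Real.log (1 / δ)) / Real.sqrt ε))
                G (fkMechanism m ε δ β (2 ^ (2 * Fintype.card V)) A (edgeDatabase G) c).2}) := by
  refine ⟨1620, by norm_num, ?_, ?_⟩
  · intro X _ _ 𝒬 h𝒬 Ω _ P _ A n₂ k ε δ β hn₂ hk hε hε1 hδ hδ1 hβ hβ1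
    refine ⟨fkMechanism_isDifferentiallyPrivate h𝒬 P A hn₂ hk hε hε1 hδ hδ1 hβ hβ1, ?_⟩
    intro hδ2 hkβ D hD
    refine (fkMechanism_answersAccurate h𝒬 P A hn₂ hk hε hε1 hδ hδ2 hβ hβ1 hkβ hD).trans
      (measure_mono ?_)
    intro c hc t
    obtain ⟨a, ha, hacc⟩ := hc t
    refine ⟨a, ha, hacc.trans (mul_le_mul_of_nonneg_right (by norm_num) ?_)⟩
    positivity
  · intro V _ _ _ Ω _ P _ A m ε δ β hm hε hε1 hδ hδ1 hβ hβ1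
    have h𝒬 : ∀ q ∈ cutQueries V, IsLinearQuery q := by
      rintro q ⟨S, T, rfl⟩
      exact isLinearQuery_cutQuery S T
    have hk : 1 ≤ 2 ^ (2 * Fintype.card V) := Nat.one_le_two_pow
    refine ⟨fkMechanism_isDifferentiallyPrivate h𝒬 P A hm hk hε hε1 hδ (by linarith) hβ
      (by linarith), ?_⟩
    intro G hG
    have hkβ : 2 * β ≤ ((2 ^ (2 * Fintype.card V) : ℕ) : ℝ) := by
      have : (1 : ℝ) ≤ ((2 ^ (2 * Fintype.card V) : ℕ) : ℝ) := by exact_mod_cast hk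
      linarith
    refine (fkMechanism_answersAccurate h𝒬 P A hm hk hε hε1 hδ hδ1 hβ (by linarith) hkβ
      ((sum_edgeDatabase_sq G).trans_le hG)).trans (measure_mono ?_)
    intro c hc t
    obtain ⟨a, ha, hacc⟩ := hc t
    refine ⟨a, ha, fun S T hST => ?_⟩
    rw [hST] at hacc
    rw [← queryValue_cutQuery_edgeDatabase, ← mul_sub, abs_mul, abs_two]
    exact (mul_le_mul_of_nonneg_left hacc two_pos.le).trans (cut_error_le hδ hδ1 hβ hβ1)
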